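/- Theorem. Let $V$ be a real vector space of dimension $m\ge 4$. View $\otimes^2V^*\otimes\operatorname{End}(V)$ as the space of operator-valued bilinear forms $\mathcal R:(x,y)\mapsto\mathcal R(x,y)\in\operatorname{End}(V)$ and $\otimes^2V^*$ as the space of bilinear forms on $V$, with the natural actions of $GL(V)$, namely $(g\cdot\mathcal R)(x,y)z=g\,\mathcal R(g^{-1}x,g^{-1}y)g^{-1}z$ and $(g\cdot\psi)(x,y)=\psi(g^{-1}x,g^{-1}y)$. Put $$\rho_{14}(\mathcal R)(x,y)=\operatorname{Tr}\{z\mapsto\mathcal R(z,x)y\},\qquad \rho_{34}(\mathcal R)(x,y)=\operatorname{Tr}\{z\mapsto\mathcal R(x,y)z\},$$ and let $\Lambda^2(V^*)$ and $S^2(V^*)$ be the spaces of alternating and of symmetric bilinear forms on $V$, with the projections $\pi_a(\psi)(x,y)=\frac12(\psi(x,y)-\psi(y,x))$ and $\pi_s(\psi)(x,y)=\frac12(\psi(x,y)+\psi(y,x))$ of $\otimes^2V^*$. Let - $\mathfrak R(V)$ be the space of all $\mathcal R$ with $\mathcal R(x,y)z=-\mathcal R(y,x)z$ and $\mathcal R(x,y)z+\mathcal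 R(y,z)x+\mathcal R(z,x)y=0$ for all $x,y,z\in V$; - $\mathfrak F(V)$ be the space of all $\mathcal F\in\mathfrak R(V)$ such that $\rho_{14}(\mathcal F)$ is symmetric and $\rho_{34}(\mathcal F)=0$; - $\mathfrak U(V)=\ker(\rho_{14})\cap\mathfrak R(V)$. These are $GL(V)$-invariant subspaces. There are $GL(V)$-equivariant short exact sequences $$0\to\mathfrak F(V)\to\mathfrak R(V)\xrightarrow{\ \pi_a\circ\rho_{14}\ }\Lambda^2(V^*)\to0,\qquad 0\to\mathfrak U(V)\to\mathfrak F(V)\xrightarrow{\ \pi_s\circ\rho_{14}\ }S^2(V^*)\to0,$$ whose first maps are the inclusions, and which are equivariantly split, respectively, by the maps $$\sigma_a(\omega)(x,y)z=\tfrac{-1}{1+m}\{2\omega(x,y)z+\omega(x,z)y-\omega(y,z)x\}\quad(\omega\in\Lambda^2(V^*)),$$ $$\sigma_s(\psi)(x,y)z=\tfrac{1}{1-m}\{\psi(x,z)y-\psi(y,z)x\}\quad(\psi\in S^2(V^*)).$$ Consequently $(\mathcal U,\psi)\mapsto\mathcal U+\sigma_s(\psi)$ is a $GL(V)$-equivariant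 isomorphism $\mathfrak U(V)\oplus S^2(V^*)\cong\mathfrak F(V)$, in which $\mathfrak U(V)$ and $S^2(V^*)$ are irreducible $GL(V)$-modules, and $$\dim\mathfrak U(V)=\frac{m^2(m^2-4)}3,\qquad\dim S^2(V^*)=\frac{m(m+1)}2,\qquad\dim\mathfrak F(V)=\frac{m(m-1)(2m^2+2m-3)}6.$$ -/

import Mathlib

noncomputable section

namespace AffineCurvature

open Module

variable (V : Type*) [AddCommGroup V] [Module ℝ V]

/-- `GL(V)`. -/
abbrev GLV := LinearMap.GeneralLinearGroup ℝ V

/-- `V* ⊗ V* ⊗ End(V)`: operator-valued bilinear forms, `𝓡 x y z` being `𝓡(x,y)z`. -/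
abbrev OpForm := V →ₗ[ℝ] V →ₗ[ℝ] V →ₗ[ℝ] V

/-- `V* ⊗ V*`: bilinear forms on `V`. -/
abbrev BilForm := V →ₗ[ℝ] V →ₗ[ℝ] ℝ

/-- The defining representation of `GL(V)` on `V`. -/
def stdRep : Representation ℝ (GLV V) V := Units.coeHom (Module.End ℝ V)

/-- The natural action of `GL(V)` on operator-valued bilinear forms:
`(g • 𝓡)(x,y)z = g (𝓡(g⁻¹ x, g⁻¹ y) g⁻¹ z)`. -/
def opRep : Representation ℝ (GLV V) (OpForm V) :=
  (stdRep V).linHom ((stdRep V).linHom ((stdRep V).linHom (stdRep V)))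

/-- The natural action of `GL(V)` on bilinear forms: `(g • ψ)(x,y) = ψ(g⁻¹ x, g⁻¹ y)`. -/
def bilRep : Representation ℝ (GLV V) (BilForm V) :=
  (stdRep V).linHom ((stdRep V).linHom (Representation.trivial ℝ (GLV V) ℝ))

variable {V}

@[simp] theorem opRep_apply (g : GLV V) (R : OpForm V) (x y z : V) :
    opRep V g R x y z = g.1 (R (g⁻¹.1 x) (g⁻¹.1 y) (g⁻¹.1 z)) := rfl

@[simp] theorem bilRep_apply (g : GLV V) (ψ : BilForm V) (x y : V) :
    bilRep V g ψ x y = ψ (g⁻¹.1 x) (g⁻¹.1 y) := rfl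

/-- `ρ₁₄(𝓡)(x,y) = Tr {z ↦ 𝓡(z,x)y}`. -/
def rho14 : OpForm V →ₗ[ℝ] BilForm V where
  toFun R := LinearMap.mk₂ ℝ (fun x y => LinearMap.trace ℝ V ((R.flip x).flip y))
    (fun x x' y => by rw [← map_add]; congr 1; ext z; simp)
    (fun c x y => by rw [← map_smul]; congr 1; ext z; simp)
    (fun x y y' => by rw [← map_add]; congr 1; ext z; simp)
    (fun c x y => by rw [← map_smul]; congr 1; ext z; simp)
  map_add' R S := by
    ext x y
    simp only [LinearMap.mk₂_apply, LinearMap.add_apply]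
    rw [← map_add]; congr 1
  map_smul' c R := by
    ext x y
    simp only [LinearMap.mk₂_apply, LinearMap.smul_apply, RingHom.id_apply]
    rw [← map_smul]; congr 1

/-- `ρ₃₄(𝓡)(x,y) = Tr {z ↦ 𝓡(x,y)z}`. -/
def rho34 : OpForm V →ₗ[ℝ] BilForm V where
  toFun R := R.compr₂ (LinearMap.trace ℝ V)
  map_add' R S := by ext x y; simp
  map_smul' c R := by ext x y; simp

theorem rho14_apply (R : OpForm V) (x y : V) :
    rho14 R x y = LinearMap.trace ℝ V
      { toFun := fun z => R z x y, map_add' := by simp, map_smul' := by simp } := rfl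

theorem rho34_apply (R : OpForm V) (x y : V) :
    rho34 R x y = LinearMap.trace ℝ V
      { toFun := fun z => R x y z, map_add' := by simp, map_smul' := by simp } := rfl

/-- `π_a(ψ)(x,y) = ½ (ψ(x,y) - ψ(y,x))`. -/
def piA : BilForm V →ₗ[ℝ] BilForm V where
  toFun ψ := (1 / 2 : ℝ) • (ψ - ψ.flip)
  map_add' φ ψ := by ext x y; simp; ring
  map_smul' c ψ := by ext x y; simp; ring

/-- `π_s(ψ)(x,y) = ½ (ψ(x,y) + ψ(y,x))`. -/
def piS : BilForm V →ₗ[ℝ] BilForm V where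
  toFun ψ := (1 / 2 : ℝ) • (ψ + ψ.flip)
  map_add' φ ψ := by ext x y; simp; ring
  map_smul' c ψ := by ext x y; simp; ring

theorem piA_apply (ψ : BilForm V) (x y : V) : piA ψ x y = (1 / 2 : ℝ) * (ψ x y - ψ y x) := rfl

theorem piS_apply (ψ : BilForm V) (x y : V) : piS ψ x y = (1 / 2 : ℝ) * (ψ x y + ψ y x) := rfl

/-- `σ_a(ω)(x,y)z = -1/(1+m) * (2 ω(x,y) z + ω(x,z) y - ω(y,z) x)` with `m = dim V`. -/
def sigmaA (ω : BilForm V) : OpForm V :=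
  LinearMap.mk₂ ℝ (fun x y =>
    { toFun := fun z => (-1 / (1 + (finrank ℝ V : ℝ))) •
        ((2 * ω x y) • z + ω x z • y - ω y z • x)
      map_add' := fun z z' => by simp only [map_add]; module
      map_smul' := fun c z => by
        simp only [map_smul, smul_eq_mul, RingHom.id_apply]; module })
    (fun x x' y => by ext z; simp; module)
    (fun c x y => by ext z; simp; module)
    (fun x y y' => by ext z; simp; module)
    (fun c x y => by ext z; simp; module)

/-- `σ_s(ψ)(x,y)z = 1/(1-m) * (ψ(x,z) y - ψ(y,z) x)` with `m = dim V`. -/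
def sigmaS (ψ : BilForm V) : OpForm V :=
  LinearMap.mk₂ ℝ (fun x y =>
    { toFun := fun z => (1 / (1 - (finrank ℝ V : ℝ))) • (ψ x z • y - ψ y z • x)
      map_add' := fun z z' => by simp only [map_add]; module
      map_smul' := fun c z => by
        simp only [map_smul, smul_eq_mul, RingHom.id_apply]; module })
    (fun x x' y => by ext z; simp; module)
    (fun c x y => by ext z; simp; module)
    (fun x y y' => by ext z; simp; module)
    (fun c x y => by ext z; simp; module)

theorem sigmaA_apply (ω : BilForm V) (x y z : V) :
    sigmaA ω x y z = (-1 / (1 + (finrank ℝ V : ℝ))) •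
      ((2 * ω x y) • z + ω x z • y - ω y z • x) := rfl

theorem sigmaS_apply (ψ : BilForm V) (x y z : V) :
    sigmaS ψ x y z = (1 / (1 - (finrank ℝ V : ℝ))) • (ψ x z • y - ψ y z • x) := rfl

theorem trace_conj_gl (g : GLV V) (f : V →ₗ[ℝ] V) :
    LinearMap.trace ℝ V (g.1 ∘ₗ f ∘ₗ g⁻¹.1) = LinearMap.trace ℝ V f := by
  have h := LinearMap.trace_mul_comm ℝ (M := V) g.1 (f * g⁻¹.1)
  have h2 : f * g⁻¹.1 * g.1 = f := by rw [mul_assoc, Units.inv_mul, mul_one]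
  rw [h2] at h
  exact h

theorem rho14_opRep (g : GLV V) (R : OpForm V) : rho14 (opRep V g R) = bilRep V g (rho14 R) := by
  ext x y
  rw [bilRep_apply, rho14_apply R, ← trace_conj_gl g]
  rfl

theorem rho34_opRep (g : GLV V) (R : OpForm V) : rho34 (opRep V g R) = bilRep V g (rho34 R) := by
  ext x y
  rw [bilRep_apply, rho34_apply R, ← trace_conj_gl g]
  rfl

variable (V)

/-- The additive group structure on a subspace of bilinear forms, which type class search does not
find by itself. -/
instance instBilGroup (S : Submodule ℝ (BilForm V)) : AddCommGroup S :=
  Submodule.addCommGroup (R := ℝ) (M := BilForm V) S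

/-- The additive group structure on a subspace of operator-valued bilinear forms. -/
instance instOpGroup (S : Submodule ℝ (OpForm V)) : AddCommGroup S :=
  Submodule.addCommGroup (R := ℝ) (M := OpForm V) S

/-- The space `Λ²(V*)` of alternating bilinear forms. -/
def altSubmodule : Submodule ℝ (BilForm V) where
  carrier := {ω | ∀ x y, ω x y = -ω y x}
  add_mem' {a b} ha hb x y := by
    simp only [LinearMap.add_apply, ha x y, hb x y]; ring
  zero_mem' x y := by simp
  smul_mem' c a ha x y := by
    simp only [LinearMap.smul_apply, ha x y, smul_neg]

/-- The space `S²(V*)` of symmetric bilinear forms. -/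
def symSubmodule : Submodule ℝ (BilForm V) where
  carrier := {ψ | ∀ x y, ψ x y = ψ y x}
  add_mem' {a b} ha hb x y := by
    simp only [LinearMap.add_apply, ha x y, hb x y]
  zero_mem' x y := by simp
  smul_mem' c a ha x y := by
    simp only [LinearMap.smul_apply, ha x y]

/-- The space `ℜ(V)` of curvature operators: the operator-valued bilinear forms that are
skew-symmetric and satisfy the first Bianchi identity. -/
def curvSubmodule : Submodule ℝ (OpForm V) where
  carrier := {R | (∀ x y z, R x y z = -R y x z) ∧ ∀ x y z, R x y z + R y z x + R z x y = 0}
  add_mem' {a b} ha hb := by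
    refine ⟨fun x y z => ?_, fun x y z => ?_⟩
    · simp only [LinearMap.add_apply, ha.1 x y z, hb.1 x y z]; abel
    · have h := congrArg₂ (· + ·) (ha.2 x y z) (hb.2 x y z)
      simp only [add_zero] at h
      simp only [LinearMap.add_apply]
      rw [← h]; abel
  zero_mem' := by simp
  smul_mem' c a ha := by
    refine ⟨fun x y z => ?_, fun x y z => ?_⟩
    · simp only [LinearMap.smul_apply, ha.1 x y z, smul_neg]
    · simp only [LinearMap.smul_apply, ← smul_add, ha.2 x y z, smul_zero]

/-- The space `𝔉(V)` of affine curvature operators: the curvature operators `𝓕` with `ρ₁₄(𝓕)`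
symmetric and `ρ₃₄(𝓕) = 0`. -/
def affSubmodule : Submodule ℝ (OpForm V) where
  carrier := {F | (∀ x y z, F x y z = -F y x z) ∧ (∀ x y z, F x y z + F y z x + F z x y = 0) ∧
    (∀ x y, rho14 F x y = rho14 F y x) ∧ rho34 F = 0}
  add_mem' {a b} ha hb := by
    obtain ⟨h1, h2⟩ := (curvSubmodule V).add_mem (x := a) (y := b) ⟨ha.1, ha.2.1⟩ ⟨hb.1, hb.2.1⟩
    refine ⟨h1, h2, fun x y => ?_, ?_⟩
    · simp only [map_add, LinearMap.add_apply, ha.2.2.1 x y, hb.2.2.1 x y]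
    · rw [map_add, ha.2.2.2, hb.2.2.2, add_zero]
  zero_mem' := by simp
  smul_mem' c a ha := by
    obtain ⟨h1, h2⟩ := (curvSubmodule V).smul_mem (x := a) c ⟨ha.1, ha.2.1⟩
    refine ⟨h1, h2, fun x y => ?_, ?_⟩
    · simp only [map_smul, LinearMap.smul_apply, ha.2.2.1 x y]
    · rw [map_smul, ha.2.2.2, smul_zero]

/-- `Λ²(V*)` as a `GL(V)`-module. -/
def Alt2 : Subrepresentation (bilRep V) where
  toSubmodule := altSubmodule V
  apply_mem_toSubmodule g a ha x y := by
    simp only [bilRep_apply]; exact ha _ _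

/-- `S²(V*)` as a `GL(V)`-module. -/
def SymB : Subrepresentation (bilRep V) where
  toSubmodule := symSubmodule V
  apply_mem_toSubmodule g a ha x y := by
    simp only [bilRep_apply]; exact ha _ _

theorem opRep_mem_curv (g : GLV V) {a : OpForm V} (ha : a ∈ curvSubmodule V) :
    opRep V g a ∈ curvSubmodule V := by
  refine ⟨fun x y z => ?_, fun x y z => ?_⟩
  · simp only [opRep_apply]; rw [ha.1, map_neg]
  · simp only [opRep_apply, ← map_add, ha.2, map_zero]

/-- `ℜ(V)` as a `GL(V)`-module. -/
def CurvR : Subrepresentation (opRep V) where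
  toSubmodule := curvSubmodule V
  apply_mem_toSubmodule g _ ha := opRep_mem_curv V g ha

/-- `𝔉(V)` as a `GL(V)`-module. -/
def AffF : Subrepresentation (opRep V) where
  toSubmodule := affSubmodule V
  apply_mem_toSubmodule g a ha := by
    obtain ⟨h1, h2⟩ := opRep_mem_curv V g (a := a) ⟨ha.1, ha.2.1⟩
    refine ⟨h1, h2, fun x y => ?_, ?_⟩
    · rw [rho14_opRep, bilRep_apply, bilRep_apply, ha.2.2.1]
    · rw [rho34_opRep, ha.2.2.2, map_zero]

/-- `𝔘(V) = ker ρ₁₄ ∩ ℜ(V)` as a `GL(V)`-module. -/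
def ProjU : Subrepresentation (opRep V) where
  toSubmodule := LinearMap.ker rho14 ⊓ curvSubmodule V
  apply_mem_toSubmodule g a ha := by
    refine ⟨?_, opRep_mem_curv V g ha.2⟩
    have h : rho14 a = 0 := ha.1
    change rho14 (opRep V g a) = 0
    rw [rho14_opRep, h, map_zero]

variable {V}

/-- `0 → A --i--> B --p--> C → 0` is a short exact sequence of representations, split by the
equivariant map `s`. -/
structure IsSplitShortExact {G A B C : Type*} [Group G] [AddCommGroup A] [Module ℝ A]
    [AddCommGroup B] [Module ℝ B] [AddCommGroup C] [Module ℝ C]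
    {α : Representation ℝ G A} {β : Representation ℝ G B} {γ : Representation ℝ G C}
    (i : α.IntertwiningMap β) (p : β.IntertwiningMap γ) (s : γ.IntertwiningMap β) : Prop where
  injective : Function.Injective i
  exact : Function.Exact i p
  surjective : Function.Surjective p
  split : ∀ c, p (s c) = c

end AffineCurvature

end

noncomputable section

namespace AffineCurvature

open Module

/-! ### Traces of curvature operators and the maps σ_a, σ_s -/

section Splittings

variable {V : Type*} [AddCommGroup V] [Module ℝ V]

/-! Tracing the Bianchi identity shows that on ℜ(V) the form ρ₃₄ is determined by the skew part of
ρ₁₄, so 𝔉(V) is exactly the kernel of π_a ∘ ρ₁₄ (`mem_aff_iff`), and 𝔘(V) is the kernel of ρ₁₄ on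
𝔉(V). Since σ_a and σ_s are equivariant sections of ρ₁₄ with values in the right spaces
(`rho14_sigmaA`, `rho14_sigmaS`), the exact sequences, their splittings and the direct sum are
formal. The dimensions follow by additivity from that of ℜ(V): a curvature operator is freely
determined by its values on semistandard triples of shape (2,1), of which there are m(m² - 1)/3.

Irreducibility of both modules is proved by one elementary argument. Let N be a nonzero invariant
subspace. (1) An element vanishes as soon as one kind of coefficient vanishes in every basis: ψ(b_i,
b_i) in the symmetric case (`sym_eq_zero_of_isotropic`), the b_l-coefficient of R(b_i, b_j)b_i for
distinct i, j, l in the case of 𝔘(V) (`projU_eq_zero_of_basis`). (2) So some element of N has a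
nonzero coefficient of this kind in some basis. Projecting to its weight space under a diagonal
transformation, which is a line, puts into N an explicit vector: α ⊗ α, respectively (α ∧ β) ⊗ α ⊗ v
(`sqForm_mem_of_ne_zero`, `wedgeForm_mem_of_ne_zero`). (3) For the inner product of coefficients,
pairing with the translates of this vector reads off, up to a factor, the coefficients of (1) in all
bases. Hence an element of the module orthogonal to N is zero, and N is everything
(`eq_of_pairing`). -/

theorem sigmaS_opRep (g : GLV V) (ψ : BilForm V) :
    opRep V g (sigmaS ψ) = sigmaS (bilRep V g ψ) := by
  have hg : ∀ v, g.1 (g⁻¹.1 v) = v := fun v => by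
    rw [← Module.End.mul_apply, Units.mul_inv, Module.End.one_apply]
  ext x y z
  simp only [opRep_apply, sigmaS_apply, bilRep_apply, map_smul, map_sub, hg]

theorem sigmaA_opRep (g : GLV V) (ψ : BilForm V) :
    opRep V g (sigmaA ψ) = sigmaA (bilRep V g ψ) := by
  have hg : ∀ v, g.1 (g⁻¹.1 v) = v := fun v => by
    rw [← Module.End.mul_apply, Units.mul_inv, Module.End.one_apply]
  ext x y z
  simp only [opRep_apply, sigmaA_apply, bilRep_apply, map_smul, map_sub, map_add, hg]

theorem piA_bilRep (g : GLV V) (ψ : BilForm V) : piA (bilRep V g ψ) = bilRep V g (piA ψ) := rfl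

theorem piS_bilRep (g : GLV V) (ψ : BilForm V) : piS (bilRep V g ψ) = bilRep V g (piS ψ) := rfl

theorem piA_mem (ψ : BilForm V) : piA ψ ∈ altSubmodule V := fun x y => by
  simp only [piA_apply]; ring

theorem piS_mem (ψ : BilForm V) : piS ψ ∈ symSubmodule V := fun x y => by
  simp only [piS_apply]; ring

theorem piA_eq_self {ψ : BilForm V} (h : ψ ∈ altSubmodule V) : piA ψ = ψ := by
  ext x y; rw [piA_apply, h y x]; ring

theorem piS_eq_self {ψ : BilForm V} (h : ψ ∈ symSubmodule V) : piS ψ = ψ := by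
  ext x y; rw [piS_apply, h y x]; ring

theorem piA_eq_zero_iff {ψ : BilForm V} : piA ψ = 0 ↔ ∀ x y, ψ x y = ψ y x := by
  constructor
  · intro h x y
    have := congrArg (fun φ : BilForm V => φ x y) h
    simp only [piA_apply, LinearMap.zero_apply] at this
    linarith
  · intro h; ext x y; simp [piA_apply, h x y]

theorem sigmaA_mem_curv {ω : BilForm V} (h : ω ∈ altSubmodule V) : sigmaA ω ∈ curvSubmodule V := by
  refine ⟨fun x y z => ?_, fun x y z => ?_⟩
  · simp only [sigmaA_apply, h y x]; module
  · simp only [sigmaA_apply, h z x, h z y, h y x]; module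

theorem sigmaS_mem_curv {ψ : BilForm V} (h : ψ ∈ symSubmodule V) : sigmaS ψ ∈ curvSubmodule V := by
  refine ⟨fun x y z => ?_, fun x y z => ?_⟩
  · simp only [sigmaS_apply]; module
  · simp only [sigmaS_apply, h z x, h z y, h y x]; module

/-- `σ_a` as a linear map. -/
def sigmaALin : BilForm V →ₗ[ℝ] OpForm V where
  toFun := sigmaA
  map_add' a b := by
    ext x y z; simp only [sigmaA_apply, LinearMap.add_apply]; module
  map_smul' a b := by
    ext x y z
    simp only [sigmaA_apply, LinearMap.smul_apply, smul_eq_mul, RingHom.id_apply]; module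

/-- `σ_s` as a linear map. -/
def sigmaSLin : BilForm V →ₗ[ℝ] OpForm V where
  toFun := sigmaS
  map_add' a b := by
    ext x y z; simp only [sigmaS_apply, LinearMap.add_apply]; module
  map_smul' a b := by
    ext x y z
    simp only [sigmaS_apply, LinearMap.smul_apply, smul_eq_mul, RingHom.id_apply]; module

variable [FiniteDimensional ℝ V]

theorem trace_smul_sub (f : V →ₗ[ℝ] ℝ) (v : V) (c : ℝ) (F : V →ₗ[ℝ] V)
    (hF : ∀ z, F z = f z • v - c • z) :
    LinearMap.trace ℝ V F = f v - c * finrank ℝ V := by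
  have : F = f.smulRight v - c • LinearMap.id := by ext z; simp [hF]
  rw [this, map_sub, map_smul, LinearMap.trace_smulRight, LinearMap.trace_id, smul_eq_mul]

theorem rho14_sigmaS (hV : 1 < finrank ℝ V) (ψ : BilForm V) :
    rho14 (sigmaS ψ) = ψ := by
  ext x y
  rw [rho14_apply, trace_smul_sub ((1 / (1 - (finrank ℝ V : ℝ))) • ψ.flip y) x
    ((1 / (1 - (finrank ℝ V : ℝ))) * ψ x y)]
  · have : (1 - (finrank ℝ V : ℝ)) ≠ 0 := by
      have : (1 : ℝ) < finrank ℝ V := by exact_mod_cast hV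
      linarith
    simp only [LinearMap.smul_apply, LinearMap.flip_apply, smul_eq_mul]
    field_simp
  · intro z
    simp only [LinearMap.coe_mk, AddHom.coe_mk, sigmaS_apply, LinearMap.smul_apply,
      LinearMap.flip_apply, smul_eq_mul]
    module

/-- The three terms contribute 2ω(y,x), ω(x,y) and -mω(x,y) to the trace; by skewness they add up to
-(1+m)ω(x,y), which the normalising factor cancels. -/
theorem rho14_sigmaA {ω : BilForm V} (h : ω ∈ altSubmodule V) :
    rho14 (sigmaA ω) = ω := by
  ext x y
  have h1 : LinearMap.trace ℝ V (((-1 / (1 + (finrank ℝ V : ℝ))) • (2 : ℝ) • ω.flip x).smulRight y +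
      (((-1 / (1 + (finrank ℝ V : ℝ))) • ω.flip y).smulRight x -
      ((-1 / (1 + (finrank ℝ V : ℝ))) * ω x y) • LinearMap.id)) = ω x y := by
    rw [map_add, map_sub, map_smul, LinearMap.trace_smulRight, LinearMap.trace_smulRight,
      LinearMap.trace_id]
    have : (1 + (finrank ℝ V : ℝ)) ≠ 0 := by positivity
    simp only [LinearMap.smul_apply, LinearMap.flip_apply, smul_eq_mul]
    rw [h y x]
    field_simp
    ring
  rw [rho14_apply, ← h1]
  congr 1
  ext z
  simp only [LinearMap.coe_mk, AddHom.coe_mk, sigmaA_apply, LinearMap.smul_apply,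
    LinearMap.flip_apply, smul_eq_mul, LinearMap.add_apply, LinearMap.sub_apply,
    LinearMap.smulRight_apply, LinearMap.id_apply]
  module

omit [FiniteDimensional ℝ V] in
-- This is the trace over z of the Bianchi identity, after R(y,z)x is turned into -R(z,y)x.
theorem rho34_eq_of_mem_curv {R : OpForm V} (h : R ∈ curvSubmodule V) (x y : V) :
    rho34 R x y = rho14 R y x - rho14 R x y := by
  rw [rho14_apply, rho14_apply, rho34_apply, ← map_sub]
  congr 1
  ext z
  have h1 := h.2 x y z
  have h2 := h.1 z y x
  simp only [LinearMap.coe_mk, AddHom.coe_mk, LinearMap.sub_apply]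
  rw [h2, ← sub_eq_zero, ← h1]
  abel

omit [FiniteDimensional ℝ V] in
-- Once ρ₁₄ is symmetric, ρ₃₄ = 0 is automatic by the traced Bianchi identity; this is what makes
-- the first sequence exact in the middle.
theorem mem_aff_iff {R : OpForm V} :
    R ∈ affSubmodule V ↔ R ∈ curvSubmodule V ∧ piA (rho14 R) = 0 := by
  rw [piA_eq_zero_iff]
  constructor
  · exact fun h => ⟨⟨h.1, h.2.1⟩, h.2.2.1⟩
  · rintro ⟨h1, h2⟩
    refine ⟨h1.1, h1.2, h2, ?_⟩
    ext x y
    rw [rho34_eq_of_mem_curv h1, h2 x y, sub_self, LinearMap.zero_apply, LinearMap.zero_apply]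

theorem sigmaS_mem_aff (hV : 1 < finrank ℝ V) {ψ : BilForm V} (h : ψ ∈ symSubmodule V) :
    sigmaS ψ ∈ affSubmodule V :=
  mem_aff_iff.2 ⟨sigmaS_mem_curv h, by rw [rho14_sigmaS hV, piA_eq_zero_iff]; exact h⟩

omit [FiniteDimensional ℝ V] in
theorem projU_le_aff : (ProjU V).toSubmodule ≤ affSubmodule V := fun R hR =>
  mem_aff_iff.2 ⟨hR.2, by rw [show rho14 R = 0 from hR.1, map_zero]⟩

omit [FiniteDimensional ℝ V] in
theorem piS_rho14_of_mem_aff {R : OpForm V} (h : R ∈ affSubmodule V) :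
    piS (rho14 R) = rho14 R := piS_eq_self h.2.2.1

end Splittings

/-! ### The split exact sequences and the direct sum -/

section Sequences

variable (V : Type*) [AddCommGroup V] [Module ℝ V]

/-- The inclusion `𝔉(V) → ℜ(V)`. -/
def inclAffCurv : (AffF V).toRepresentation.IntertwiningMap (CurvR V).toRepresentation where
  toLinearMap := Submodule.inclusion (p := (AffF V).toSubmodule) (p' := (CurvR V).toSubmodule)
    fun _ h => (mem_aff_iff.1 h).1
  isIntertwining' _ := rfl

/-- The inclusion `𝔘(V) → 𝔉(V)`. -/
def inclUAff : (ProjU V).toRepresentation.IntertwiningMap (AffF V).toRepresentation where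
  toLinearMap := Submodule.inclusion (p := (ProjU V).toSubmodule) (p' := (AffF V).toSubmodule)
    projU_le_aff
  isIntertwining' _ := rfl

/-- `π_a ∘ ρ₁₄ : ℜ(V) → Λ²(V*)`. -/
def projAlt : (CurvR V).toRepresentation.IntertwiningMap (Alt2 V).toRepresentation where
  toLinearMap := LinearMap.codRestrict (Alt2 V).toSubmodule
    ((piA ∘ₗ rho14) ∘ₗ (CurvR V).toSubmodule.subtype) fun _ => piA_mem _
  isIntertwining' g := by
    refine LinearMap.ext fun R => Subtype.ext ?_
    change piA (rho14 (opRep V g R.1)) = bilRep V g (piA (rho14 R.1))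
    rw [rho14_opRep, piA_bilRep]

/-- `π_s ∘ ρ₁₄ : 𝔉(V) → S²(V*)`. -/
def projSym : (AffF V).toRepresentation.IntertwiningMap (SymB V).toRepresentation where
  toLinearMap := LinearMap.codRestrict (SymB V).toSubmodule
    ((piS ∘ₗ rho14) ∘ₗ (AffF V).toSubmodule.subtype) fun _ => piS_mem _
  isIntertwining' g := by
    refine LinearMap.ext fun R => Subtype.ext ?_
    change piS (rho14 (opRep V g R.1)) = bilRep V g (piS (rho14 R.1))
    rw [rho14_opRep, piS_bilRep]

/-- `σ_a : Λ²(V*) → ℜ(V)`. -/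
def splitAlt : (Alt2 V).toRepresentation.IntertwiningMap (CurvR V).toRepresentation where
  toLinearMap := LinearMap.codRestrict (CurvR V).toSubmodule
    (sigmaALin ∘ₗ (Alt2 V).toSubmodule.subtype) fun ω => sigmaA_mem_curv ω.2
  isIntertwining' g := by
    refine LinearMap.ext fun R => Subtype.ext ?_
    exact (sigmaA_opRep g R.1).symm

variable [FiniteDimensional ℝ V]

/-- `σ_s : S²(V*) → 𝔉(V)`. -/
def splitSym (hV : 1 < finrank ℝ V) :
    (SymB V).toRepresentation.IntertwiningMap (AffF V).toRepresentation where
  toLinearMap := LinearMap.codRestrict (AffF V).toSubmodule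
    (sigmaSLin ∘ₗ (SymB V).toSubmodule.subtype) fun ω => sigmaS_mem_aff hV ω.2
  isIntertwining' g := by
    refine LinearMap.ext fun R => Subtype.ext ?_
    exact (sigmaS_opRep g R.1).symm

theorem projAlt_splitAlt (ω : (Alt2 V).toSubmodule) : projAlt V (splitAlt V ω) = ω := by
  refine Subtype.ext ?_
  change piA (rho14 (sigmaA ω.1)) = ω.1
  rw [rho14_sigmaA ω.2, piA_eq_self ω.2]

theorem projSym_splitSym (hV : 1 < finrank ℝ V) (ψ : (SymB V).toSubmodule) :
    projSym V (splitSym V hV ψ) = ψ := by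
  refine Subtype.ext ?_
  change piS (rho14 (sigmaS ψ.1)) = ψ.1
  rw [rho14_sigmaS hV, piS_eq_self ψ.2]

omit [FiniteDimensional ℝ V] in
theorem exact_alt : Function.Exact (inclAffCurv V) (projAlt V) := by
  intro R
  constructor
  · intro h
    exact ⟨⟨R.1, mem_aff_iff.2 ⟨R.2, congrArg Subtype.val h⟩⟩, rfl⟩
  · rintro ⟨F, rfl⟩
    exact Subtype.ext (mem_aff_iff.1 F.2).2

omit [FiniteDimensional ℝ V] in
-- On 𝔉(V) the form ρ₁₄ is already symmetric, so π_s ∘ ρ₁₄ and ρ₁₄ have the same kernel there.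
theorem exact_sym : Function.Exact (inclUAff V) (projSym V) := by
  intro F
  constructor
  · intro h
    refine ⟨⟨F.1, ?_, (mem_aff_iff.1 F.2).1⟩, rfl⟩
    have h2 : piS (rho14 F.1) = 0 := congrArg Subtype.val h
    rwa [piS_rho14_of_mem_aff F.2] at h2
  · rintro ⟨U, rfl⟩
    refine Subtype.ext ?_
    change piS (rho14 U.1) = 0
    rw [show rho14 U.1 = 0 from U.2.1, map_zero]

omit [FiniteDimensional ℝ V] in
theorem inclAffCurv_injective : Function.Injective (inclAffCurv V) :=
  Submodule.inclusion_injective fun _ h => (mem_aff_iff.1 h).1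

omit [FiniteDimensional ℝ V] in
theorem inclUAff_injective : Function.Injective (inclUAff V) :=
  Submodule.inclusion_injective projU_le_aff

theorem isSplitShortExact_alt :
    IsSplitShortExact (inclAffCurv V) (projAlt V) (splitAlt V) where
  injective := inclAffCurv_injective V
  exact := exact_alt V
  surjective c := ⟨_, projAlt_splitAlt V c⟩
  split := projAlt_splitAlt V

theorem isSplitShortExact_sym (hV : 1 < finrank ℝ V) :
    IsSplitShortExact (inclUAff V) (projSym V) (splitSym V hV) where
  injective := inclUAff_injective V
  exact := exact_sym V
  surjective c := ⟨_, projSym_splitSym V hV c⟩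
  split := projSym_splitSym V hV

/-- `(𝓤, ψ) ↦ 𝓤 + σ_s(ψ)`. -/
def sumMap (hV : 1 < finrank ℝ V) :
    ((ProjU V).toSubmodule × (SymB V).toSubmodule) →ₗ[ℝ] (AffF V).toSubmodule :=
  (inclUAff V).toLinearMap.coprod (splitSym V hV).toLinearMap

/-- Projecting recovers ψ from 𝓤 + σ_s(ψ); the remainder lies in the kernel of the projection, which
is 𝔘(V). -/
theorem sumMap_bijective (hV : 1 < finrank ℝ V) : Function.Bijective (sumMap V hV) := by
  have key : ∀ p : (ProjU V).toSubmodule × (SymB V).toSubmodule,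
      projSym V (sumMap V hV p) = p.2 := fun p => by
    change projSym V (inclUAff V p.1 + splitSym V hV p.2) = p.2
    rw [map_add, projSym_splitSym, (exact_sym V _).2 ⟨p.1, rfl⟩, zero_add]
  constructor
  · intro p q h
    have h2 : p.2 = q.2 := by rw [← key p, ← key q, h]
    refine Prod.ext (inclUAff_injective V ?_) h2
    change inclUAff V p.1 + splitSym V hV p.2 = inclUAff V q.1 + splitSym V hV q.2 at h
    rw [h2] at h
    exact add_right_cancel h
  · intro F
    obtain ⟨U, hU⟩ := (exact_sym V (F - splitSym V hV (projSym V F))).1 (by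
      rw [map_sub, projSym_splitSym, sub_self])
    refine ⟨(U, projSym V F), ?_⟩
    change inclUAff V U + splitSym V hV (projSym V F) = F
    rw [hU, sub_add_cancel]

/-- The equivariant isomorphism `𝔘(V) ⊕ S²(V*) ≃ 𝔉(V)`. -/
def sumEquiv (hV : 1 < finrank ℝ V) :
    ((ProjU V).toRepresentation.prod (SymB V).toRepresentation).Equiv (AffF V).toRepresentation :=
  Representation.Equiv.mk (LinearEquiv.ofBijective (sumMap V hV) (sumMap_bijective V hV)) (by
    intro g
    refine LinearMap.ext fun p => ?_
    change inclUAff V ((ProjU V).toRepresentation g p.1) +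
      splitSym V hV ((SymB V).toRepresentation g p.2) =
      (AffF V).toRepresentation g (inclUAff V p.1 + splitSym V hV p.2)
    rw [map_add, (inclUAff V).isIntertwining, (splitSym V hV).isIntertwining])

end Sequences

/-! ### Dimension counts -/

section Dimensions

variable {V : Type*} [AddCommGroup V] [Module ℝ V]

/-- The bilinear form with prescribed coefficients in a basis. -/
def bilOfCoeff {ι : Type*} (b : Basis ι ℝ V) (c : ι → ι → ℝ) : BilForm V :=
  b.constr ℝ fun i => b.constr ℝ fun j => c i j

@[simp] theorem bilOfCoeff_apply {ι : Type*} (b : Basis ι ℝ V) (c : ι → ι → ℝ) (i j : ι) :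
    bilOfCoeff b c (b i) (b j) = c i j := by
  simp [bilOfCoeff]

/-- The operator-valued bilinear form with prescribed values on a basis. -/
def opOfCoeff {ι : Type*} (b : Basis ι ℝ V) (c : ι → ι → ι → V) : OpForm V :=
  b.constr ℝ fun i => b.constr ℝ fun j => b.constr ℝ fun k => c i j k

@[simp] theorem opOfCoeff_apply {ι : Type*} (b : Basis ι ℝ V) (c : ι → ι → ι → V) (i j k : ι) :
    opOfCoeff b c (b i) (b j) (b k) = c i j k := by
  simp [opOfCoeff]

theorem bil_ext {ι : Type*} (b : Basis ι ℝ V) {φ ψ : BilForm V}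
    (h : ∀ i j, φ (b i) (b j) = ψ (b i) (b j)) : φ = ψ :=
  b.ext fun i => b.ext fun j => h i j

theorem op_ext {ι : Type*} (b : Basis ι ℝ V) {R S : OpForm V}
    (h : ∀ i j k, R (b i) (b j) (b k) = S (b i) (b j) (b k)) : R = S :=
  b.ext fun i => b.ext fun j => b.ext fun k => h i j k

theorem mem_sym_of_basis {ι : Type*} (b : Basis ι ℝ V) {ψ : BilForm V}
    (h : ∀ i j, ψ (b i) (b j) = ψ (b j) (b i)) : ψ ∈ symSubmodule V := by
  have : ψ = ψ.flip := bil_ext b h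
  intro x y
  exact congrArg (fun φ : BilForm V => φ x y) this

theorem mem_curv_of_basis {ι : Type*} (b : Basis ι ℝ V) {R : OpForm V}
    (h1 : ∀ i j k, R (b i) (b j) (b k) = -R (b j) (b i) (b k))
    (h2 : ∀ i j k, R (b i) (b j) (b k) + R (b j) (b k) (b i) + R (b k) (b i) (b j) = 0) :
    R ∈ curvSubmodule V := by
  constructor
  · have : R = -R.flip := op_ext b h1
    intro x y z
    exact congrArg (fun S : OpForm V => S x y z) this
  -- Cyclic rotation of the arguments as a linear map: the Bianchi identity becomes an equation
  -- between operator-valued forms, which can be checked on a basis.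
  · let l3 : OpForm V →ₗ[ℝ] OpForm V :=
      { toFun := fun R => LinearMap.mk₂ ℝ (fun x y => (R.flip x).flip y)
          (by intros; ext; simp) (by intros; ext; simp) (by intros; ext; simp)
          (by intros; ext; simp)
        map_add' := fun _ _ => by ext; simp
        map_smul' := fun _ _ => by ext; simp }
    have hl : ∀ (S : OpForm V) x y z, l3 S x y z = S z x y := fun _ _ _ _ => rfl
    have : R + l3 (l3 R) + l3 R = 0 := op_ext b (by
      intro i j k
      simp only [LinearMap.add_apply, LinearMap.zero_apply, hl]
      exact h2 i j k)
    intro x y z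
    have := congrArg (fun S : OpForm V => S x y z) this
    simpa only [LinearMap.add_apply, LinearMap.zero_apply, hl] using this

/-- Coefficients identify symmetric forms with functions on unordered pairs of indices. -/
def symEquiv {ι : Type*} (b : Basis ι ℝ V) : symSubmodule V ≃ₗ[ℝ] (Sym2 ι → ℝ) where
  toFun ψ := Sym2.lift ⟨fun i j => ψ.1 (b i) (b j), fun _ _ => ψ.2 _ _⟩
  map_add' φ ψ := by
    ext p; induction p with | _ i j => rfl
  map_smul' c ψ := by
    ext p; induction p with | _ i j => rfl
  invFun f := ⟨bilOfCoeff b fun i j => f s(i, j), mem_sym_of_basis b fun i j => by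
    rw [bilOfCoeff_apply, bilOfCoeff_apply, Sym2.eq_swap]⟩
  left_inv ψ := by
    refine Subtype.ext (bil_ext b fun i j => ?_)
    simp
  right_inv f := by
    ext p; induction p with | _ i j => simp

theorem finrank_sym [FiniteDimensional ℝ V] :
    finrank ℝ (symSubmodule V) = (finrank ℝ V + 1).choose 2 := by
  rw [(symEquiv (finBasis ℝ V)).finrank_eq, finrank_fintype_fun_eq_card, Sym2.card,
    Fintype.card_fin]

theorem isCompl_alt_sym : IsCompl (altSubmodule V) (symSubmodule V) := by
  rw [isCompl_iff, Submodule.disjoint_def, codisjoint_iff, eq_top_iff]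
  constructor
  · intro ψ h1 h2
    ext x y
    have := h1 x y
    rw [← h2 x y] at this
    simp only [LinearMap.zero_apply]
    linarith
  · intro ψ _
    have : ψ = piA ψ + piS ψ := by
      ext x y
      simp only [LinearMap.add_apply, piA_apply, piS_apply]
      ring
    rw [this]
    exact Submodule.add_mem_sup (piA_mem ψ) (piS_mem ψ)

theorem finrank_alt_add_finrank_sym [FiniteDimensional ℝ V] :
    finrank ℝ (altSubmodule V) + finrank ℝ (symSubmodule V) = finrank ℝ V ^ 2 := by
  have h := Submodule.finrank_add_eq_of_isCompl (K := ℝ) (V := BilForm V) isCompl_alt_sym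
  rw [finrank_linearMap, finrank_linearMap, finrank_self, mul_one, ← sq] at h
  exact h

/-- The semistandard index triples of shape `(2,1)`. -/
abbrev SemistandardTriple (m : ℕ) := {t : Fin m × Fin m × Fin m // t.1 < t.2.1 ∧ t.1 ≤ t.2.2}

/-- For smallest index i there are (m-1-i)(m-i) choices of the other two; summing over i gives m(m²
- 1)/3. -/
theorem card_semistandardTriple (m : ℕ) :
    3 * Fintype.card (SemistandardTriple m) + m = m ^ 3 := by
  let e : SemistandardTriple m ≃ (Σ i : Fin m, {j // i < j} × {k // i ≤ k}) :=
    { toFun := fun t => ⟨t.1.1, ⟨t.1.2.1, t.2.1⟩, ⟨t.1.2.2, t.2.2⟩⟩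
      invFun := fun s => ⟨(s.1, s.2.1.1, s.2.2.1), s.2.1.2, s.2.2.2⟩
      left_inv := fun _ => rfl
      right_inv := fun _ => rfl }
  have h1 : ∀ i : Fin m, Fintype.card {j // i < j} = m - 1 - i := fun i => by
    rw [Fintype.card_subtype, ← Fin.card_Ioi]; congr 1; ext; simp
  have h2 : ∀ i : Fin m, Fintype.card {j // i ≤ j} = m - i := fun i => by
    rw [Fintype.card_subtype, ← Fin.card_Ici]; congr 1; ext; simp
  rw [Fintype.card_congr e, Fintype.card_sigma]
  simp only [Fintype.card_prod, h1, h2]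
  rw [Fin.sum_univ_eq_sum_range (fun i => (m - 1 - i) * (m - i)) m,
    ← Finset.sum_range_reflect]
  -- After reflection the summand is j(j+1). The bound n ≤ m keeps the truncated subtractions exact
  -- during the induction on partial sums.
  have : ∀ n ≤ m, 3 * ∑ j ∈ Finset.range n, (m - 1 - (m - 1 - j)) * (m - (m - 1 - j)) + n
      = n ^ 3 := by
    intro n
    induction n with
    | zero => simp
    | succ n ih =>
      intro hn
      have h3 : m - 1 - (m - 1 - n) = n := by omega
      have h4 : m - (m - 1 - n) = n + 1 := by omega
      rw [Finset.sum_range_succ, h3, h4, mul_add]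
      have := ih (by omega)
      ring_nf at this ⊢
      omega
  exact this m le_rfl

/-- The extension of a function on semistandard triples to all triples that is dictated by skew
symmetry and the Bianchi identity. -/
def extendTriple {m : ℕ} {W : Type*} [AddCommGroup W] (f : Fin m → Fin m → Fin m → W)
    (i j k : Fin m) : W :=
  -- When k is smaller than both i and j, Bianchi and skew symmetry give R(i,j)k = R(k,j)i -
  -- R(k,i)j, and both triples on the right are semistandard.
  if i < j then (if i ≤ k then f i j k else f k j i - f k i j)
  else if j < i then (if j ≤ k then -f j i k else f k j i - f k i j)
  else 0

theorem extendTriple_swap {m : ℕ} {W : Type*} [AddCommGroup W] (f : Fin m → Fin m → Fin m → W)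
    (i j k : Fin m) : extendTriple f i j k = -extendTriple f j i k := by
  unfold extendTriple
  split_ifs <;> first | omega | abel

theorem extendTriple_bianchi {m : ℕ} {W : Type*} [AddCommGroup W]
    (f : Fin m → Fin m → Fin m → W) (i j k : Fin m) :
    extendTriple f i j k + extendTriple f j k i + extendTriple f k i j = 0 := by
  rcases lt_trichotomy i j with h1 | h1 | h1 <;> rcases lt_trichotomy j k with h2 | h2 | h2 <;>
  rcases lt_trichotomy i k with h3 | h3 | h3 <;> subst_vars <;> unfold extendTriple <;>
  split_ifs <;> first | omega | abel

/-- Values on semistandard triples determine a curvature operator, and are arbitrary. -/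
theorem curv_restrict_bijective {m : ℕ} (b : Basis (Fin m) ℝ V) :
    ∃ e : curvSubmodule V →ₗ[ℝ] (SemistandardTriple m → V), Function.Bijective e := by
  refine ⟨LinearMap.pi fun t =>
    { toFun := fun R => R.1 (b t.1.1) (b t.1.2.1) (b t.1.2.2)
      map_add' := fun _ _ => rfl
      map_smul' := fun _ _ => rfl }, ?_, ?_⟩
  · refine (injective_iff_map_eq_zero _).2 ?_
    intro R hR
    have h0 : ∀ i j k, i < j → i ≤ k → R.1 (b i) (b j) (b k) = 0 := fun i j k h1 h2 =>
      congrFun hR ⟨(i, j, k), h1, h2⟩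
    have h1 : ∀ i j k, i < j → R.1 (b i) (b j) (b k) = 0 := by
      intro i j k h
      rcases le_or_gt i k with hk | hk
      · exact h0 i j k h hk
      · have e := R.2.2 (b i) (b j) (b k)
        rw [R.2.1 (b j) (b k), h0 k j i (hk.trans h) hk.le, h0 k i j hk (hk.trans h).le] at e
        simpa using e
    refine Subtype.ext (op_ext b fun i j k => ?_)
    rcases lt_trichotomy i j with h | rfl | h
    · exact h1 i j k h
    · have := R.2.1 (b i) (b i) (b k)
      rw [eq_neg_iff_add_eq_zero, ← two_smul ℝ] at this
      exact (smul_eq_zero.1 this).resolve_left two_ne_zero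
    · rw [R.2.1, h1 j i k h, neg_zero]; rfl
  · intro f
    classical
    let F : Fin m → Fin m → Fin m → V := fun i j k =>
      if h : i < j ∧ i ≤ k then f ⟨(i, j, k), h⟩ else 0
    refine ⟨⟨opOfCoeff b (extendTriple F), mem_curv_of_basis b ?_ ?_⟩, ?_⟩
    · intro i j k
      simp only [opOfCoeff_apply]
      exact extendTriple_swap _ _ _ _
    · intro i j k
      simp only [opOfCoeff_apply]
      exact extendTriple_bianchi _ _ _ _
    · ext t
      simp only [LinearMap.pi_apply, LinearMap.coe_mk, AddHom.coe_mk, opOfCoeff_apply]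
      simp [extendTriple, F, t.2.1, t.2.2]

theorem finrank_curv [FiniteDimensional ℝ V] :
    3 * finrank ℝ (curvSubmodule V) + finrank ℝ V ^ 2 = finrank ℝ V ^ 4 := by
  obtain ⟨e, he⟩ := curv_restrict_bijective (finBasis ℝ V)
  have h := card_semistandardTriple (finrank ℝ V)
  rw [(LinearEquiv.ofBijective e he).finrank_eq, finrank_pi_fintype, Finset.sum_const,
    Finset.card_univ, smul_eq_mul]
  calc _ = (3 * Fintype.card (SemistandardTriple (finrank ℝ V)) + finrank ℝ V) * finrank ℝ V := by
        ring
    _ = _ := by rw [h]; ring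

variable (V) [FiniteDimensional ℝ V]

theorem finrank_curv_eq_aff_add_alt :
    finrank ℝ (curvSubmodule V) = finrank ℝ (affSubmodule V) + finrank ℝ (altSubmodule V) := by
  have hs := isSplitShortExact_alt V
  have h := LinearMap.finrank_range_add_finrank_ker (projAlt V).toLinearMap
  have hr : LinearMap.range (projAlt V).toLinearMap = ⊤ :=
    LinearMap.range_eq_top.2 hs.surjective
  have hk : LinearMap.ker (projAlt V).toLinearMap = LinearMap.range (inclAffCurv V).toLinearMap :=
    LinearMap.exact_iff.1 hs.exact
  rw [hr, hk, finrank_top, LinearMap.finrank_range_of_inj hs.injective] at h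
  rw [add_comm]
  exact h.symm

theorem finrank_aff_eq_projU_add_sym (hV : 1 < finrank ℝ V) :
    finrank ℝ (affSubmodule V) =
      finrank ℝ (ProjU V).toSubmodule + finrank ℝ (symSubmodule V) := by
  have h := (LinearEquiv.ofBijective (sumMap V hV) (sumMap_bijective V hV)).finrank_eq
  rw [finrank_prod] at h
  exact h.symm

theorem finrank_symB_real :
    (finrank ℝ (SymB V).toSubmodule : ℝ) = (finrank ℝ V : ℝ) * ((finrank ℝ V : ℝ) + 1) / 2 := by
  change (finrank ℝ (symSubmodule V) : ℝ) = _
  rw [finrank_sym, Nat.cast_choose_two]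
  push_cast
  ring

/-- The first sequence gives dim 𝔉 = (m⁴ - m²)/3 - m(m-1)/2. -/
theorem finrank_affF_real :
    (finrank ℝ (AffF V).toSubmodule : ℝ) = (finrank ℝ V : ℝ) * ((finrank ℝ V : ℝ) - 1) *
      (2 * (finrank ℝ V : ℝ) ^ 2 + 2 * (finrank ℝ V : ℝ) - 3) / 6 := by
  change (finrank ℝ (affSubmodule V) : ℝ) = _
  have h1 : (3 * finrank ℝ (curvSubmodule V) + finrank ℝ V ^ 2 : ℝ) = finrank ℝ V ^ 4 := by
    exact_mod_cast finrank_curv (V := V)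
  have h2 : (finrank ℝ (curvSubmodule V) : ℝ) =
      finrank ℝ (affSubmodule V) + finrank ℝ (altSubmodule V) := by
    exact_mod_cast finrank_curv_eq_aff_add_alt V
  have h3 : (finrank ℝ (altSubmodule V) + finrank ℝ (symSubmodule V) : ℝ) = finrank ℝ V ^ 2 := by
    exact_mod_cast finrank_alt_add_finrank_sym (V := V)
  have h4 : (finrank ℝ (symSubmodule V) : ℝ) = _ := finrank_symB_real V
  rw [h4] at h3
  linear_combination h1 / 3 - h2 - h3

theorem finrank_projU_real (hV : 1 < finrank ℝ V) :
    (finrank ℝ (ProjU V).toSubmodule : ℝ) =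
      (finrank ℝ V : ℝ) ^ 2 * ((finrank ℝ V : ℝ) ^ 2 - 4) / 3 := by
  have h1 : (finrank ℝ (affSubmodule V) : ℝ) =
      finrank ℝ (ProjU V).toSubmodule + finrank ℝ (symSubmodule V) := by
    exact_mod_cast finrank_aff_eq_projU_add_sym V hV
  have h2 : (finrank ℝ (affSubmodule V) : ℝ) = _ := finrank_affF_real V
  have h4 : (finrank ℝ (symSubmodule V) : ℝ) = _ := finrank_symB_real V
  rw [h2, h4] at h1
  linear_combination -h1

end Dimensions

/-! ### Tools for irreducibility -/

section General

/-- A subspace stable under an operator that is diagonal in given coordinates is stable under the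
projections onto its eigenspaces. -/
theorem exists_weight_component {E S : Type*} [AddCommGroup E] [Module ℝ E] [Fintype S]
    (N : Submodule ℝ E) (f : Module.End ℝ E) (hN : ∀ v ∈ N, f v ∈ N) (c : S → E →ₗ[ℝ] ℝ)
    (w : S → ℝ) (hc : ∀ v s, c s (f v) = w s * c s v) {v : E} (hv : v ∈ N) (w₀ : ℝ) :
    ∃ u ∈ N, ∀ s, c s u = if w s = w₀ then c s v else 0 := by
  classical
  have hmem : ∀ (q : Polynomial ℝ), Polynomial.aeval f q v ∈ N := by
    intro q
    induction q using Polynomial.induction_on' with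
    | add p q hp hq => rw [map_add]; exact N.add_mem hp hq
    | monomial n a =>
      rw [Polynomial.aeval_monomial]
      refine N.smul_mem a ?_
      induction n with
      | zero => simpa using hv
      | succ n ih => rw [pow_succ']; exact hN _ ih
  have hcoord : ∀ (q : Polynomial ℝ) s, c s (Polynomial.aeval f q v) = q.eval (w s) * c s v := by
    intro q s
    induction q using Polynomial.induction_on' with
    | add p q hp hq =>
      rw [map_add, LinearMap.add_apply, map_add, hp, hq, Polynomial.eval_add, add_mul]
    | monomial n a =>
      rw [Polynomial.aeval_monomial, Polynomial.eval_monomial]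
      have : c s ((f ^ n) v) = w s ^ n * c s v := by
        induction n with
        | zero => simp
        | succ n ih => rw [pow_succ', Module.End.mul_apply, hc, ih, pow_succ']; ring
      change c s (a • (f ^ n) v) = _
      rw [map_smul, this, smul_eq_mul, mul_assoc]
  -- Lagrange interpolation: q vanishes at every eigenvalue other than w₀, so q(f)/q(w₀) acts as the
  -- projection onto the w₀-eigenspace.
  let q : Polynomial ℝ := ∏ a ∈ (Finset.univ.image w).erase w₀, (Polynomial.X - Polynomial.C a)
  have hq : ∀ a, q.eval a = ∏ d ∈ (Finset.univ.image w).erase w₀, (a - d) := fun a => by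
    simp [q, Polynomial.eval_prod]
  have hq0 : q.eval w₀ ≠ 0 := by
    rw [hq, Finset.prod_ne_zero_iff]
    intro d hd
    exact sub_ne_zero.2 (Finset.ne_of_mem_erase hd).symm
  refine ⟨(q.eval w₀)⁻¹ • Polynomial.aeval f q v, N.smul_mem _ (hmem q), fun s => ?_⟩
  rw [map_smul, hcoord, smul_eq_mul]
  split_ifs with h
  · rw [h, inv_mul_cancel_left₀ hq0]
  · have : q.eval (w s) = 0 := by
      rw [hq]
      exact Finset.prod_eq_zero (i := w s) (by simp [h]) (sub_self _)
    rw [this, zero_mul, mul_zero]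

/-- The hypothesis says that U embeds into the dual of N via B, so dim U ≤ dim N. -/
theorem eq_of_pairing {E : Type*} [AddCommGroup E] [Module ℝ E] [FiniteDimensional ℝ E]
    {N U : Submodule ℝ E} (hle : N ≤ U) (B : E →ₗ[ℝ] E →ₗ[ℝ] ℝ)
    (h : ∀ R ∈ U, (∀ S ∈ N, B R S = 0) → R = 0) : N = U := by
  let F : U →ₗ[ℝ] Dual ℝ N := B.domRestrict₁₂ U N
  have hF : Function.Injective F := by
    refine (injective_iff_map_eq_zero F).2 fun R hR => Subtype.ext (h R.1 R.2 fun S hS => ?_)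
    exact congrArg (fun φ : Dual ℝ N => φ ⟨S, hS⟩) hR
  refine Submodule.eq_of_le_of_finrank_le hle ?_
  have := LinearMap.finrank_le_finrank_of_injective hF
  rwa [Subspace.dual_finrank_eq] at this

theorem isIrreducible_of_forall_submodule {G E : Type*} [Group G] [AddCommGroup E] [Module ℝ E]
    {ρ : Representation ℝ G E} (σ : Subrepresentation ρ) (h0 : σ.toSubmodule ≠ ⊥)
    (h : ∀ N : Submodule ℝ E, N ≤ σ.toSubmodule → (∀ g, ∀ v ∈ N, ρ g v ∈ N) → N ≠ ⊥ →
      N = σ.toSubmodule) : σ.toRepresentation.IsIrreducible := by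
  have hbt : (⊥ : Subrepresentation σ.toRepresentation) ≠ ⊤ := by
    intro hb
    obtain ⟨v, hv, hv0⟩ := Submodule.exists_mem_ne_zero_of_ne_bot h0
    have : (⟨v, hv⟩ : σ.toSubmodule) ∈ (⊥ : Subrepresentation σ.toRepresentation).toSubmodule := by
      rw [hb]; exact Submodule.mem_top
    exact hv0 (congrArg Subtype.val ((Submodule.mem_bot ℝ).1 this))
  refine { exists_pair_ne := ⟨_, _, hbt⟩, eq_bot_or_eq_top := fun τ => ?_ }
  by_cases hN : τ.toSubmodule.map σ.toSubmodule.subtype = ⊥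
  · left
    apply Subrepresentation.toSubmodule_injective
    refine (Submodule.eq_bot_iff _).2 fun v hv => Subtype.ext ?_
    exact (Submodule.eq_bot_iff _).1 hN v.1 ⟨v, hv, rfl⟩
  · right
    apply Subrepresentation.toSubmodule_injective
    have := h _ (Submodule.map_subtype_le _ _) (by
      rintro g _ ⟨v, hv, rfl⟩
      exact ⟨σ.toRepresentation g v, τ.apply_mem_toSubmodule g hv, rfl⟩) hN
    refine eq_top_iff.2 fun v _ => ?_
    obtain ⟨w, hw, hwv⟩ := this.ge v.2
    rwa [← Subtype.ext hwv]

/-- The symmetric group is 3-transitive. This lets one vector with fixed indices reach the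
coefficients at all distinct triples, by relabelling bases. -/
theorem exists_perm_of_distinct {ι : Type*} [Finite ι] {i j l i' j' l' : ι} (hij : i ≠ j)
    (hil : i ≠ l) (hjl : j ≠ l) (hij' : i' ≠ j') (hil' : i' ≠ l') (hjl' : j' ≠ l') :
    ∃ σ : Equiv.Perm ι, σ i = i' ∧ σ j = j' ∧ σ l = l' := by
  classical
  have inj : ∀ {a b c : ι}, a ≠ b → a ≠ c → b ≠ c → Function.Injective ![a, b, c] := by
    intro a b c h1 h2 h3 x y
    fin_cases x <;> fin_cases y <;> simp_all [eq_comm]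
  have := Equiv.Perm.isMultiplyPretransitive ι 3
  obtain ⟨σ, hσ⟩ := MulAction.exists_smul_eq (Equiv.Perm ι)
    (⟨_, inj hij hil hjl⟩ : Fin 3 ↪ ι) ⟨_, inj hij' hil' hjl'⟩
  exact ⟨σ, congrArg (fun f => f 0) hσ, congrArg (fun f => f 1) hσ, congrArg (fun f => f 2) hσ⟩

end General

/-! ### Diagonal, contragredient and sheared bases -/

section Bases

variable {V : Type*} [AddCommGroup V] [Module ℝ V] {ι : Type*} [Fintype ι] [DecidableEq ι]

/-- The diagonal linear transformation with given eigenvalues in a basis. -/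
def diagGL (b : Basis ι ℝ V) (w : ι → ℝˣ) : GLV V where
  val := b.constr ℝ fun i => (w i : ℝ) • b i
  inv := b.constr ℝ fun i => ((w i)⁻¹ : ℝ) • b i
  val_inv := b.ext fun i => by simp
  inv_val := b.ext fun i => by simp

theorem diagGL_inv_apply (b : Basis ι ℝ V) (w : ι → ℝˣ) (i : ι) :
    (diagGL b w)⁻¹.1 (b i) = ((w i)⁻¹ : ℝ) • b i := by
  change b.constr ℝ (fun i => ((w i)⁻¹ : ℝ) • b i) (b i) = _
  simp

theorem repr_diagGL (b : Basis ι ℝ V) (w : ι → ℝˣ) (x : V) (l : ι) :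
    b.repr ((diagGL b w).1 x) l = w l * b.repr x l := by
  have : b.coord l ∘ₗ (diagGL b w).1 = (w l : ℝ) • b.coord l := b.ext fun i => by
    simp only [diagGL, LinearMap.comp_apply, Basis.constr_basis, map_smul, LinearMap.smul_apply,
      Basis.coord_apply, Basis.repr_self, smul_eq_mul]
    by_cases h : i = l
    · rw [h]
    · simp [h]
  exact congrArg (fun f : V →ₗ[ℝ] ℝ => f x) this

/-- The linear transformation whose matrix in the basis `b` is contragredient to the change of
basis from `b` to `b'`. -/
theorem exists_contragredient (b b' : Basis ι ℝ V) :
    ∃ g : GLV V, (∀ i p, b.coord i (g⁻¹.1 (b p)) = b.repr (b' i) p) ∧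
      ∀ l p, b.repr (g.1 (b l)) p = b'.repr (b p) l := by
  have h1 : b.toMatrix b' * b'.toMatrix b = 1 := Basis.toMatrix_mul_toMatrix_flip b b'
  have h2 : b'.toMatrix b * b.toMatrix b' = 1 := Basis.toMatrix_mul_toMatrix_flip b' b
  refine ⟨⟨Matrix.toLin b b (b'.toMatrix b).transpose, Matrix.toLin b b (b.toMatrix b').transpose,
    ?_, ?_⟩, ?_, ?_⟩
  · rw [Module.End.mul_eq_comp, ← Matrix.toLin_mul, ← Matrix.transpose_mul, h1,
      Matrix.transpose_one, Matrix.toLin_one]; rfl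
  · rw [Module.End.mul_eq_comp, ← Matrix.toLin_mul, ← Matrix.transpose_mul, h2,
      Matrix.transpose_one, Matrix.toLin_one]; rfl
  · intro i p
    change b.coord i (Matrix.toLin b b (b.toMatrix b').transpose (b p)) = _
    rw [Matrix.toLin_self, Basis.coord_apply, Basis.repr_sum_self, Matrix.transpose_apply,
      Basis.toMatrix_apply]
  · intro l p
    change b.repr (Matrix.toLin b b (b'.toMatrix b).transpose (b l)) p = _
    rw [Matrix.toLin_self, Basis.repr_sum_self, Matrix.transpose_apply, Basis.toMatrix_apply]

omit [Fintype ι] in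
/-- Replacing `b p` by `b p + t b q` in a basis. -/
theorem exists_sheared_basis (b : Basis ι ℝ V) {p q : ι} (hpq : p ≠ q) (t : ℝ) :
    ∃ b' : Basis ι ℝ V, (∀ i, b' i = b i + if i = p then t • b q else 0) ∧
      ∀ x l, b'.repr x l = b.repr x l - if l = q then t * b.repr x p else 0 := by
  have hf : b.coord p (t • b q) = 0 := by simp [hpq.symm]
  refine ⟨b.map (LinearEquiv.transvection hf), fun i => ?_, fun x l => ?_⟩
  · rw [Basis.map_apply, LinearEquiv.transvection.apply, Basis.coord_apply, Basis.repr_self]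
    by_cases h : i = p
    · simp [h]
    · simp [h]
  · have : (LinearEquiv.transvection hf).symm x = x - (t * b.repr x p) • b q := by
      rw [LinearEquiv.symm_apply_eq, LinearEquiv.transvection.apply, map_sub, map_smul]
      simp [hpq.symm, smul_smul, mul_comm]
    rw [Basis.map_repr, LinearEquiv.trans_apply, this, map_sub, map_smul, Basis.repr_self]
    by_cases h : l = q
    · simp [h]
    · simp [h]

end Bases

/-! ### Irreducibility of S²(V*) -/

section Symmetric

variable {V : Type*} [AddCommGroup V] [Module ℝ V] {ι : Type*} [Fintype ι] [DecidableEq ι]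

/-- The coefficients of a bilinear form in a basis. -/
def bilCoeff (b : Basis ι ℝ V) (s : ι × ι) : BilForm V →ₗ[ℝ] ℝ where
  toFun ψ := ψ (b s.1) (b s.2)
  map_add' _ _ := rfl
  map_smul' _ _ := rfl

/-- The inner product of coefficients of bilinear forms in a basis. -/
def bilPairing (b : Basis ι ℝ V) : BilForm V →ₗ[ℝ] BilForm V →ₗ[ℝ] ℝ :=
  ∑ s, (bilCoeff b s).smulRight (bilCoeff b s)

/-- The square of a linear form. -/
def sqForm (α : V →ₗ[ℝ] ℝ) : BilForm V := α.smulRight α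

omit [DecidableEq ι] in
-- When α has the same coordinates as a, both sides are the double sum of ψ(b_i, b_j) a_i a_j.
theorem bilPairing_sqForm (b : Basis ι ℝ V) (ψ : BilForm V) (α : V →ₗ[ℝ] ℝ) (a : V)
    (ha : ∀ p, α (b p) = b.repr a p) : bilPairing b ψ (sqForm α) = ψ a a := by
  conv_rhs => rw [← b.sum_repr a]
  simp only [bilPairing, LinearMap.sum_apply, LinearMap.smulRight_apply, LinearMap.smul_apply,
    bilCoeff, LinearMap.coe_mk, AddHom.coe_mk, sqForm, smul_eq_mul, map_sum, map_smul, ha,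
    Fintype.sum_prod_type, Finset.mul_sum]
  rw [Finset.sum_comm]
  refine Finset.sum_congr rfl fun i _ => Finset.sum_congr rfl fun j _ => ?_
  ring

omit [Fintype ι] in
-- Polarisation: b_i + b_j is itself a member of a basis, so the off-diagonal coefficients vanish
-- too.
theorem sym_eq_zero_of_isotropic (b : Basis ι ℝ V) {ψ : BilForm V} (hψ : ψ ∈ symSubmodule V)
    (h : ∀ (b' : Basis ι ℝ V) i, ψ (b' i) (b' i) = 0) : ψ = 0 := by
  refine bil_ext b fun i j => ?_
  by_cases hij : i = j
  · rw [hij, h b j]; rfl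
  · obtain ⟨b', hb', -⟩ := exists_sheared_basis b hij 1
    have := h b' i
    rw [hb', if_pos rfl, one_smul, map_add, map_add, LinearMap.add_apply, LinearMap.add_apply,
      h b i, h b j, hψ (b j) (b i)] at this
    simp only [LinearMap.zero_apply]
    linarith

theorem sqForm_mem_of_ne_zero {N : Submodule ℝ (BilForm V)}
    (hN : ∀ g, ∀ ψ ∈ N, bilRep V g ψ ∈ N) (b : Basis ι ℝ V) {ψ : BilForm V} (hψ : ψ ∈ N) {i : ι}
    (h : ψ (b i) (b i) ≠ 0) : sqForm (b.coord i) ∈ N := by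
  -- Scaling only b_i by 2 gives the coefficient (p,q) the eigenvalue 1, 1/2 or 1/4, and 1/4 occurs
  -- for (i,i) alone.
  let n : ι → ℕ := fun a => if a = i then 1 else 0
  let w : ι → ℝˣ := fun a => Units.mk0 ((2 : ℝ) ^ n a) (by positivity)
  obtain ⟨u, hu, hus⟩ := exists_weight_component (E := BilForm V) (S := ι × ι) N
    (bilRep V (diagGL b w)) (hN _) (bilCoeff b) (fun s : ι × ι => (w s.1 : ℝ)⁻¹ * (w s.2 : ℝ)⁻¹) (by
      intro ψ s
      change ψ ((diagGL b w)⁻¹.1 (b s.1)) ((diagGL b w)⁻¹.1 (b s.2)) = _ * ψ (b s.1) (b s.2)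
      rw [diagGL_inv_apply, diagGL_inv_apply, map_smul, map_smul, LinearMap.smul_apply,
        smul_eq_mul, smul_eq_mul]
      ring) hψ (4⁻¹)
  have : u = ψ (b i) (b i) • sqForm (b.coord i) := by
    refine bil_ext b fun p q => ?_
    have := hus (p, q)
    simp only [bilCoeff, LinearMap.coe_mk, AddHom.coe_mk] at this
    rw [this]
    simp only [w, n, Units.val_mk0, sqForm, LinearMap.smul_apply, LinearMap.smulRight_apply,
      Basis.coord_apply, Basis.repr_self, smul_eq_mul, Finsupp.single_apply]
    by_cases hp : p = i <;> by_cases hq : q = i <;> simp [hp, hq]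
    norm_num
  rw [this] at hu
  exact (N.smul_mem_iff h).1 hu

theorem eq_sym_of_invariant [FiniteDimensional ℝ V] (b : Basis ι ℝ V)
    {N : Submodule ℝ (BilForm V)} (hle : N ≤ symSubmodule V)
    (hN : ∀ g, ∀ ψ ∈ N, bilRep V g ψ ∈ N) (h0 : N ≠ ⊥) : N = symSubmodule V := by
  obtain ⟨ψ, hψ, hψ0⟩ := Submodule.exists_mem_ne_zero_of_ne_bot h0
  obtain ⟨b₀, i₀, hi₀⟩ : ∃ (b' : Basis ι ℝ V) (i : ι), ψ (b' i) (b' i) ≠ 0 := by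
    by_contra! hcon
    exact hψ0 (sym_eq_zero_of_isotropic b (hle hψ) hcon)
  have hmem := sqForm_mem_of_ne_zero hN b₀ hψ hi₀
  refine eq_of_pairing (E := BilForm V) hle (bilPairing b₀) fun φ hφ hφN =>
    sym_eq_zero_of_isotropic b hφ ?_
  intro b₁ i
  -- The vector in N sits at the fixed index i₀, so b₁ is relabelled to bring its i-th vector there.
  let b' := b₁.reindex (Equiv.swap i i₀)
  have hb' : b' i₀ = b₁ i := by simp [b']
  obtain ⟨g, hg, -⟩ := exists_contragredient b₀ b'
  have h1 := hφN _ (hN g _ hmem)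
  have h2 : bilRep V g (sqForm (b₀.coord i₀)) = sqForm (b₀.coord i₀ ∘ₗ g⁻¹.1) := rfl
  rw [h2, bilPairing_sqForm b₀ φ _ (b' i₀) (fun p => hg i₀ p), hb'] at h1
  exact h1

end Symmetric

/-! ### Linear algebra of Ricci-flat coefficients -/

section Coefficients

variable {ι : Type*} [Fintype ι] [DecidableEq ι]

/-- Coefficients with the symmetries of a Ricci-flat curvature operator vanish if those with a
repeated index and an otherwise unrelated upper index do, and the identities obtained from this in
sheared bases hold. -/
theorem coeff_eq_zero (hcard : 3 ≤ Fintype.card ι) (r : ι → ι → ι → ι → ℝ)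
    (skew : ∀ i j k l, r i j k l = -r j i k l)
    (bian : ∀ i j k l, r i j k l + r j k i l + r k i j l = 0)
    (tr : ∀ j k, ∑ l, r l j k l = 0)
    (h1 : ∀ i j l, i ≠ j → i ≠ l → j ≠ l → r i j i l = 0)
    (h2 : ∀ i j k l, i ≠ j → i ≠ k → i ≠ l → j ≠ k → j ≠ l → k ≠ l → r i j k l + r k j i l = 0)
    (h3 : ∀ i j l, i ≠ j → i ≠ l → j ≠ l → r i j i i = r i j l l + r l j i l)
    (h4 : ∀ i j l, i ≠ j → i ≠ l → j ≠ l → r i l i l = r i j i j) (i j k l : ι) :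
    r i j k l = 0 := by
  have hc : (3 : ℝ) ≤ Fintype.card ι := by exact_mod_cast hcard
  have skew0 : ∀ i k l, r i i k l = 0 := fun i k l => by have := skew i i k l; linarith
  -- With u = r l j i l and v = r l i j l, Bianchi gives r i j l l = u - v, so `h3` reads r i j i i
  -- = 2u - v and r j i j j = 2v - u; solve for u. In particular u does not depend on l.
  have hu : ∀ i j l, i ≠ j → i ≠ l → j ≠ l → 3 * r l j i l = 2 * r i j i i + r j i j j := by
    intro i j l hij hil hjl
    have e1 := h3 i j l hij hil hjl
    have e2 := h3 j i l hij.symm hjl hil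
    have e3 := bian i j l l
    have e4 := skew j l i l
    have e5 := skew j i l l
    linarith
  -- Vanishing of the trace ∑ r l j i l: the term l = j is zero, l = i gives r i j i i, and the
  -- other m - 2 terms all equal u. Adding and subtracting the equations for (i,j) and (j,i) then
  -- decouples them.
  have hp' : ∀ i j, i ≠ j →
      3 * r i j i i + (Fintype.card ι - 2) * (2 * r i j i i + r j i j j) = 0 := by
    intro i j hij
    have e : ∀ l, 3 * r l j i l = (2 * r i j i i + r j i j j) +
        ((if l = i then 3 * r i j i i - (2 * r i j i i + r j i j j) else 0) +
        (if l = j then -(2 * r i j i i + r j i j j) else 0)) := by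
      intro l
      by_cases hi : l = i
      · subst hi; simp [hij]
      · by_cases hj : l = j
        · subst hj; simp [hi, skew0]
        · rw [if_neg hi, if_neg hj, add_zero, add_zero, hu i j l hij (Ne.symm hi) (Ne.symm hj)]
    have s : ∑ l, 3 * r l j i l = 0 := by rw [← Finset.mul_sum, tr, mul_zero]
    rw [Finset.sum_congr rfl fun l _ => e l] at s
    simp only [Finset.sum_add_distrib, Finset.sum_const, Finset.card_univ,
      Finset.sum_ite_eq', Finset.mem_univ, if_true, nsmul_eq_mul] at s
    linarith
  have hp : ∀ i j, i ≠ j → r i j i i = 0 := by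
    intro i j hij
    have e1 := hp' i j hij
    have e2 := hp' j i hij.symm
    have e3 : (r i j i i + r j i j j) * (3 * Fintype.card ι - 3) = 0 := by linarith
    have e4 : (r i j i i - r j i j j) * (Fintype.card ι + 1) = 0 := by linarith
    have e5 := (mul_eq_zero.1 e3).resolve_right (by linarith)
    have e6 := (mul_eq_zero.1 e4).resolve_right (by linarith)
    linarith
  have hu0 : ∀ i j l, i ≠ j → i ≠ l → j ≠ l → r l j i l = 0 := by
    intro i j l hij hil hjl
    have := hu i j l hij hil hjl
    rw [hp i j hij, hp j i hij.symm] at this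
    linarith
  -- By `h4` this coefficient does not depend on j, so the trace ∑ r l i i l is -(m-1) times it.
  have hq : ∀ i j, i ≠ j → r i j i j = 0 := by
    intro i j hij
    have e : ∀ l, r l i i l = -r i j i j + if l = i then r i j i j else 0 := by
      intro l
      by_cases hi : l = i
      · subst hi; simp [skew0]
      · rw [if_neg hi, add_zero, skew]
        by_cases hj : l = j
        · rw [hj]
        · rw [h4 i j l hij (Ne.symm hi) (Ne.symm hj)]
    have s := tr i i
    simp only [e, Finset.sum_add_distrib, Finset.sum_const, Finset.card_univ,
      Finset.sum_ite_eq', Finset.mem_univ, if_true, nsmul_eq_mul] at s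
    have s' : r i j i j * (Fintype.card ι - 1) = 0 := by linarith
    exact (mul_eq_zero.1 s').resolve_right (by linarith)
  have hrep : ∀ i j l, i ≠ j → r i j i l = 0 := by
    intro i j l hij
    by_cases hi : l = i
    · rw [hi]; exact hp i j hij
    · by_cases hj : l = j
      · rw [hj]; exact hq i j hij
      · exact h1 i j l hij (Ne.symm hi) (Ne.symm hj)
  by_cases hij : i = j
  · rw [hij]; exact skew0 _ _ _
  by_cases hik : i = k
  · rw [← hik]; exact hrep i j l hij
  by_cases hjk : j = k
  · rw [← hjk, skew, hrep j i l (Ne.symm hij), neg_zero]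
  by_cases hil : i = l
  · rw [← hil]; exact hu0 k j i (Ne.symm hjk) (Ne.symm hik) (Ne.symm hij)
  by_cases hjl : j = l
  · rw [← hjl, skew, hu0 k i j (Ne.symm hik) (Ne.symm hjk) hij, neg_zero]
  by_cases hkl : k = l
  · have := h3 i j k hij hik hjk
    rw [hp i j hij, hu0 i j k hij hik hjk] at this
    rw [← hkl]; linarith
  -- For four distinct indices r is skew in its first three arguments, so the three Bianchi terms
  -- coincide and 3 r i j k l = 0.
  have e1 := h2 i j k l hij hik hil hjk hjl hkl
  have e2 := h2 i k j l hik hij hil (Ne.symm hjk) hkl hjl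
  have e3 := bian i j k l
  have e4 := skew j k i l
  have e5 := skew k i j l
  linarith

end Coefficients

/-! ### Irreducibility of 𝔘(V) -/

section Curvature

variable {V : Type*} [AddCommGroup V] [Module ℝ V] {ι : Type*} [Fintype ι] [DecidableEq ι]

/-- The coefficients of an operator-valued bilinear form in a basis. -/
def opCoeff (b : Basis ι ℝ V) (s : ι × ι × ι × ι) : OpForm V →ₗ[ℝ] ℝ where
  toFun R := b.repr (R (b s.1) (b s.2.1) (b s.2.2.1)) s.2.2.2
  map_add' _ _ := by simp
  map_smul' _ _ := by simp

/-- The inner product of coefficients of operator-valued bilinear forms in a basis. -/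
def opPairing (b : Basis ι ℝ V) : OpForm V →ₗ[ℝ] OpForm V →ₗ[ℝ] ℝ :=
  ∑ s, (opCoeff b s).smulRight (opCoeff b s)

/-- The operator-valued form `(x, y) z ↦ (α ∧ β)(x, y) α(z) v`. -/
def wedgeForm (α β : V →ₗ[ℝ] ℝ) (v : V) : OpForm V :=
  (α.smulRight β - β.smulRight α).compr₂ ((LinearMap.toSpanSingleton ℝ (V →ₗ[ℝ] V))
    (α.smulRight v))

theorem wedgeForm_apply (α β : V →ₗ[ℝ] ℝ) (v x y z : V) :
    wedgeForm α β v x y z = (α x * β y - β x * α y) • α z • v := rfl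

theorem opRep_wedgeForm (g : GLV V) (α β : V →ₗ[ℝ] ℝ) (v : V) :
    opRep V g (wedgeForm α β v) = wedgeForm (α ∘ₗ g⁻¹.1) (β ∘ₗ g⁻¹.1) (g.1 v) := by
  ext x y z
  simp only [opRep_apply, wedgeForm_apply, map_smul, LinearMap.comp_apply]

omit [DecidableEq ι] in
theorem repr_apply_eq_sum (b b' : Basis ι ℝ V) (R : OpForm V) (x y z : V) (l : ι) :
    b'.repr (R x y z) l = ∑ p, ∑ q, ∑ s, ∑ t, b.repr x p * b.repr y q * b.repr z s *
      b'.repr (b t) l * opCoeff b (p, q, s, t) R := by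
  have h : ∀ w : V, b'.repr w l = ∑ t, b'.repr (b t) l * b.repr w t := fun w => by
    conv_lhs => rw [← b.sum_repr w]
    simp only [map_sum, map_smul, Finsupp.finsetSum_apply, Finsupp.smul_apply, smul_eq_mul,
      mul_comm]
  conv_lhs => rw [← b.sum_repr x, ← b.sum_repr y, ← b.sum_repr z]
  simp only [map_sum, map_smul, LinearMap.sum_apply, LinearMap.smul_apply, Finsupp.finsetSum_apply,
    Finsupp.smul_apply, smul_eq_mul, Finset.mul_sum]
  simp only [h (R _ _ _), Finset.mul_sum]
  refine (Finset.sum_congr rfl fun s _ => Finset.sum_comm).trans ?_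
  rw [Finset.sum_comm]
  refine Finset.sum_congr rfl fun p _ => ?_
  rw [Finset.sum_comm]
  refine Finset.sum_congr rfl fun q _ => Finset.sum_congr rfl fun s _ =>
    Finset.sum_congr rfl fun t _ => ?_
  simp only [opCoeff, LinearMap.coe_mk, AddHom.coe_mk]
  ring

omit [DecidableEq ι] in
-- The two terms of α ∧ β contribute R(x,y)x and -R(y,x)x, equal by skew symmetry, hence the factor
-- 2. The vector v represents, in b-coordinates, the l-th coordinate functional of b'.
theorem opPairing_wedgeForm (b b' : Basis ι ℝ V) {R : OpForm V} (hR : R ∈ curvSubmodule V)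
    (α β : V →ₗ[ℝ] ℝ) (v x y : V) (l : ι) (hα : ∀ p, α (b p) = b.repr x p)
    (hβ : ∀ p, β (b p) = b.repr y p) (hv : ∀ p, b.repr v p = b'.repr (b p) l) :
    opPairing b R (wedgeForm α β v) = 2 * b'.repr (R x y x) l := by
  have h : 2 * b'.repr (R x y x) l = b'.repr (R x y x) l - b'.repr (R y x x) l := by
    rw [hR.1 y x x, map_neg, Finsupp.neg_apply]; ring
  rw [h, repr_apply_eq_sum b, repr_apply_eq_sum b]
  simp only [opPairing, LinearMap.sum_apply, LinearMap.smulRight_apply, LinearMap.smul_apply,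
    Fintype.sum_prod_type, ← Finset.sum_sub_distrib]
  refine Finset.sum_congr rfl fun p _ => Finset.sum_congr rfl fun q _ =>
    Finset.sum_congr rfl fun s _ => Finset.sum_congr rfl fun t _ => ?_
  have : opCoeff b (p, q, s, t) (wedgeForm α β v) =
      (b.repr x p * b.repr y q - b.repr y p * b.repr x q) * b.repr x s * b'.repr (b t) l := by
    simp only [opCoeff, LinearMap.coe_mk, AddHom.coe_mk, wedgeForm_apply, map_smul,
      Finsupp.smul_apply, smul_eq_mul, hα, hβ, hv]
    ring
  rw [this, smul_eq_mul]
  ring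

theorem rho14_eq_sum (b : Basis ι ℝ V) (R : OpForm V) (x y : V) :
    rho14 R x y = ∑ l, b.repr (R (b l) x y) l := by
  rw [rho14_apply, LinearMap.trace_eq_matrix_trace ℝ b, Matrix.trace]
  refine Finset.sum_congr rfl fun l _ => ?_
  rw [Matrix.diag_apply, LinearMap.toMatrix_apply]
  rfl

/-- A Ricci-flat curvature operator for which `R(x,y)x` always lies in the span of `x` and `y`
vanishes. -/
theorem projU_eq_zero_of_basis (hcard : 3 ≤ Fintype.card ι) (b : Basis ι ℝ V) {R : OpForm V}
    (hR : R ∈ (ProjU V).toSubmodule)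
    (h : ∀ (b' : Basis ι ℝ V) i j l, i ≠ j → i ≠ l → j ≠ l →
      b'.repr (R (b' i) (b' j) (b' i)) l = 0) : R = 0 := by
  have h0 : rho14 R = 0 := hR.1
  have hc : R ∈ curvSubmodule V := hR.2
  refine op_ext b fun i j k => b.ext_elem fun l => ?_
  simp only [LinearMap.zero_apply, map_zero, Finsupp.zero_apply]
  refine coeff_eq_zero hcard (fun i j k l => b.repr (R (b i) (b j) (b k)) l)
    ?_ ?_ ?_ ?_ ?_ ?_ ?_ i j k l
  · intro i j k l
    rw [hc.1, map_neg, Finsupp.neg_apply]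
  · intro i j k l
    have := congrArg (fun v => b.repr v l) (hc.2 (b i) (b j) (b k))
    simpa using this
  · intro j k
    have := rho14_eq_sum b R (b j) (b k)
    rw [h0] at this
    exact this.symm
  · exact h b
  · intro i j k l hij hik hil hjk hjl hkl
    -- Polarise in b_i + b_k; the b_l-coordinate is unaffected.
    obtain ⟨b', hb, hr⟩ := exists_sheared_basis b hik 1
    have e := h b' i j l hij hil hjl
    have e1 := h b i j l hij hil hjl
    have e2 := h b k j l hjk.symm hkl hjl
    rw [hr, hb, hb, if_pos rfl, if_neg hij.symm, if_neg hkl.symm] at e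
    simp only [one_smul, add_zero, map_add, LinearMap.add_apply, Finsupp.add_apply] at e
    linarith
  · intro i j l hij hil hjl
    -- Replacing b_i by b_i + t b_l also changes the b_l-coordinate, giving a cubic polynomial in t
    -- that vanishes. Its linear coefficient is the claim: t = 1 and t = -1 isolate the odd part,
    -- whose cubic term is zero by `e2`.
    have e : ∀ t : ℝ, b.repr (R (b i) (b j) (b i)) l + t * b.repr (R (b l) (b j) (b i)) l +
        t * (b.repr (R (b i) (b j) (b l)) l + t * b.repr (R (b l) (b j) (b l)) l) -
        t * (b.repr (R (b i) (b j) (b i)) i + t * b.repr (R (b l) (b j) (b i)) i +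
        t * (b.repr (R (b i) (b j) (b l)) i + t * b.repr (R (b l) (b j) (b l)) i)) = 0 :=
        fun t => by
      obtain ⟨b', hb, hr⟩ := exists_sheared_basis b hil t
      have e := h b' i j l hij hil hjl
      rw [hr, hb, hb, if_pos rfl, if_neg hij.symm, if_pos rfl] at e
      simp only [add_zero, map_add, LinearMap.add_apply, Finsupp.add_apply, map_smul,
        LinearMap.smul_apply, Finsupp.smul_apply, smul_eq_mul] at e
      linear_combination e
    have e1 := h b i j l hij hil hjl
    have e2 := h b l j i hjl.symm hil.symm hij.symm
    have e3 := e 1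
    have e4 := e (-1)
    linarith
  · intro i j l hij hil hjl
    -- Replacing b_j by b_j + b_l turns the b_l-coordinate into the difference of the l- and
    -- j-coordinates; the two mixed terms vanish by `e1` and `e2`.
    obtain ⟨b', hb, hr⟩ := exists_sheared_basis b hjl 1
    have e := h b' i j l hij hil hjl
    have e1 := h b i j l hij hil hjl
    have e2 := h b i l j hil hij hjl.symm
    rw [hr, hb, hb, if_pos rfl, if_neg hij, if_pos rfl] at e
    simp only [one_smul, add_zero, map_add, LinearMap.add_apply, Finsupp.add_apply, one_mul] at e
    linarith

omit [Fintype ι] in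
/-- The only index quadruples of the weight of `(i, j, i; l)`. -/
theorem weight_eq_iff {i j l : ι} (hij : i ≠ j) (hil : i ≠ l) (hjl : j ≠ l) (n : ι → ℕ)
    (hn : ∀ a, n a = if a = i then 1 else if a = j then 5 else if a = l then 30 else 0)
    (p q s t : ι) : n t = 23 + n p + n q + n s ↔
      t = l ∧ ((p = i ∧ q = j ∧ s = i) ∨ (p = j ∧ q = i ∧ s = i) ∨ (p = i ∧ q = i ∧ s = j)) := by
  -- Here 23 = 30 - 1 - 5 - 1. Since 0, 1 and 5 are below 23, the upper index must be l; and 7 is a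
  -- sum of three of the numbers 0, 1, 5, 30 only as 1 + 1 + 5.
  have hi : n i = 1 := by simp [hn]
  have hj : n j = 5 := by simp [hn, hij.symm]
  have hl : n l = 30 := by simp [hn, hil.symm, hjl.symm]
  have hcases : ∀ a, (a = i ∧ n a = 1) ∨ (a = j ∧ n a = 5) ∨ (a = l ∧ n a = 30) ∨
      (a ≠ i ∧ a ≠ j ∧ a ≠ l ∧ n a = 0) := by
    intro a
    by_cases h1 : a = i
    · left; exact ⟨h1, h1 ▸ hi⟩
    by_cases h2 : a = j
    · right; left; exact ⟨h2, h2 ▸ hj⟩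
    by_cases h3 : a = l
    · right; right; left; exact ⟨h3, h3 ▸ hl⟩
    · right; right; right; exact ⟨h1, h2, h3, by simp [hn, h1, h2, h3]⟩
  constructor
  · intro h
    have ht : t = l := by
      rcases hcases t with h' | h' | h' | h'
      · omega
      · omega
      · exact h'.1
      · omega
    refine ⟨ht, ?_⟩
    rw [ht, hl] at h
    rcases hcases p with hp | hp | hp | hp <;> rcases hcases q with hq | hq | hq | hq <;>
      first | omega | skip
    all_goals rcases hcases s with hs | hs | hs | hs <;> first | omega | simp [hp.1, hq.1, hs.1]
  · rintro ⟨rfl, ⟨rfl, rfl, rfl⟩ | ⟨rfl, rfl, rfl⟩ | ⟨rfl, rfl, rfl⟩⟩ <;> omega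

/-- The weight of the coefficient (i, j, i; l) occurs otherwise only at (j, i, i; l), its negative,
and at (i, i, j; l), which is zero by skew symmetry. So its weight space in ℜ(V) is the line spanned
by this form. -/
theorem wedgeForm_mem_of_ne_zero {N : Submodule ℝ (OpForm V)} (hle : N ≤ curvSubmodule V)
    (hN : ∀ g, ∀ R ∈ N, opRep V g R ∈ N) (b : Basis ι ℝ V) {R : OpForm V} (hR : R ∈ N)
    {i j l : ι} (hij : i ≠ j) (hil : i ≠ l) (hjl : j ≠ l)
    (h : b.repr (R (b i) (b j) (b i)) l ≠ 0) : wedgeForm (b.coord i) (b.coord j) (b l) ∈ N := by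
  let n : ι → ℕ := fun a => if a = i then 1 else if a = j then 5 else if a = l then 30 else 0
  let w : ι → ℝˣ := fun a => Units.mk0 ((2 : ℝ) ^ n a) (by positivity)
  obtain ⟨u, hu, hus⟩ := exists_weight_component (E := OpForm V) (S := ι × ι × ι × ι) N
    (opRep V (diagGL b w)) (hN _) (opCoeff b)
    (fun s => (w s.2.2.2 : ℝ) * ((w s.1 : ℝ)⁻¹ * (w s.2.1 : ℝ)⁻¹ * (w s.2.2.1 : ℝ)⁻¹)) (by
      intro S s
      change b.repr ((diagGL b w).1 (S ((diagGL b w)⁻¹.1 (b s.1)) ((diagGL b w)⁻¹.1 (b s.2.1))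
        ((diagGL b w)⁻¹.1 (b s.2.2.1)))) s.2.2.2 =
        _ * b.repr (S (b s.1) (b s.2.1) (b s.2.2.1)) s.2.2.2
      rw [repr_diagGL]
      simp only [diagGL_inv_apply, map_smul, LinearMap.smul_apply, Finsupp.smul_apply,
        smul_eq_mul]
      ring) hR (2 ^ 23)
  have hweight : ∀ p q s t : ι, (w t : ℝ) * ((w p : ℝ)⁻¹ * (w q : ℝ)⁻¹ * (w s : ℝ)⁻¹) = 2 ^ 23 ↔
      t = l ∧ ((p = i ∧ q = j ∧ s = i) ∨ (p = j ∧ q = i ∧ s = i) ∨ (p = i ∧ q = i ∧ s = j)) := by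
    intro p q s t
    rw [← weight_eq_iff hij hil hjl n (fun _ => rfl),
      ← (pow_right_injective₀ (a := (2 : ℝ)) (by norm_num) (by norm_num)).eq_iff (a := n t)]
    simp only [w, Units.val_mk0, pow_add]
    have hp : (2 : ℝ) ^ n p ≠ 0 := by positivity
    have hq : (2 : ℝ) ^ n q ≠ 0 := by positivity
    have hs : (2 : ℝ) ^ n s ≠ 0 := by positivity
    field_simp
  have hRc := hle hR
  have : u = b.repr (R (b i) (b j) (b i)) l • wedgeForm (b.coord i) (b.coord j) (b l) := by
    refine op_ext b fun p q s => b.ext_elem fun t => ?_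
    have e := hus (p, q, s, t)
    simp only [hweight] at e
    simp only [opCoeff, LinearMap.coe_mk, AddHom.coe_mk] at e
    rw [e]
    simp only [LinearMap.smul_apply, wedgeForm_apply, map_smul, Finsupp.smul_apply, smul_eq_mul,
      Basis.coord_apply, Basis.repr_self, Finsupp.single_apply]
    by_cases hc : t = l ∧
        ((p = i ∧ q = j ∧ s = i) ∨ (p = j ∧ q = i ∧ s = i) ∨ (p = i ∧ q = i ∧ s = j))
    · rw [if_pos hc]
      obtain ⟨ht, ⟨hp, hq, hs⟩ | ⟨hp, hq, hs⟩ | ⟨hp, hq, hs⟩⟩ := hc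
      · rw [ht, hp, hq, hs]
        simp [hij, hij.symm]
      · rw [ht, hp, hq, hs, hRc.1]
        simp [hij, hij.symm]
      · have h0 : R (b i) (b i) (b j) = 0 := by
          have := hRc.1 (b i) (b i) (b j)
          rw [eq_neg_iff_add_eq_zero, ← two_smul ℝ] at this
          exact (smul_eq_zero.1 this).resolve_left two_ne_zero
        rw [ht, hp, hq, hs, h0]
        simp [hij.symm]
    · rw [if_neg hc]
      by_cases ht : t = l
      · by_cases hs : s = i
        · by_cases hp : p = i
          · have hq : q ≠ j := fun hq => hc ⟨ht, Or.inl ⟨hp, hq, hs⟩⟩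
            simp [hp, hq, hij]
          · by_cases hp' : p = j
            · have hq : q ≠ i := fun hq => hc ⟨ht, Or.inr (Or.inl ⟨hp', hq, hs⟩)⟩
              simp [hp, hq]
            · simp [hp, hp']
        · simp [hs]
      · simp [Ne.symm ht]
  rw [this] at hu
  exact (N.smul_mem_iff h).1 hu

theorem eq_projU_of_invariant [FiniteDimensional ℝ V] (hcard : 3 ≤ Fintype.card ι)
    (b : Basis ι ℝ V) {N : Submodule ℝ (OpForm V)} (hle : N ≤ (ProjU V).toSubmodule)
    (hN : ∀ g, ∀ R ∈ N, opRep V g R ∈ N) (h0 : N ≠ ⊥) : N = (ProjU V).toSubmodule := by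
  obtain ⟨R, hR, hR0⟩ := Submodule.exists_mem_ne_zero_of_ne_bot h0
  obtain ⟨b₀, i₀, j₀, l₀, hij₀, hil₀, hjl₀, hne⟩ : ∃ (b' : Basis ι ℝ V) (i j l : ι),
      i ≠ j ∧ i ≠ l ∧ j ≠ l ∧ b'.repr (R (b' i) (b' j) (b' i)) l ≠ 0 := by
    by_contra! hcon
    exact hR0 (projU_eq_zero_of_basis hcard b (hle hR) hcon)
  have hmem := wedgeForm_mem_of_ne_zero (fun S hS => (hle hS).2) hN b₀ hR hij₀ hil₀ hjl₀ hne
  refine eq_of_pairing (E := OpForm V) hle (opPairing b₀) fun S hS hSN =>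
    projU_eq_zero_of_basis hcard b hS ?_
  intro b₁ i j l hij hil hjl
  -- Relabelling b₁ moves the arbitrary distinct triple to (i₀, j₀, l₀), the indices of the vector
  -- known to lie in N.
  obtain ⟨σ, rfl, rfl, rfl⟩ := exists_perm_of_distinct hij₀ hil₀ hjl₀ hij hil hjl
  let b' := b₁.reindex σ.symm
  have hb' : ∀ a, b' a = b₁ (σ a) := fun a => by simp [b']
  obtain ⟨g, hg, hg'⟩ := exists_contragredient b₀ b'
  have h1 := hSN _ (hN g _ hmem)
  rw [opRep_wedgeForm, opPairing_wedgeForm b₀ b' hS.2 _ _ _ (b' i₀) (b' j₀) l₀ (hg i₀) (hg j₀)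
    (hg' l₀)] at h1
  have h2 : b'.repr (S (b' i₀) (b' j₀) (b' i₀)) l₀ = 0 := by linarith
  rw [hb', hb'] at h2
  simpa [b'] using h2

end Curvature

/-! ### Conclusion: both modules are nonzero and irreducible -/

section Irreducible

variable (V : Type*) [AddCommGroup V] [Module ℝ V] [FiniteDimensional ℝ V]

theorem symB_isIrreducible (hV : 0 < finrank ℝ V) :
    (SymB V).toRepresentation.IsIrreducible := by
  refine isIrreducible_of_forall_submodule (E := BilForm V) (ρ := bilRep V) (SymB V)
    (fun h => ?_) fun N hle hN h0 =>
    eq_sym_of_invariant (finBasis ℝ V) hle hN h0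
  have h1 := finrank_symB_real V
  rw [h, finrank_bot] at h1
  have : (0 : ℝ) < finrank ℝ V := by exact_mod_cast hV
  have : (0 : ℝ) < (finrank ℝ V : ℝ) * ((finrank ℝ V : ℝ) + 1) / 2 := by positivity
  simp only [Nat.cast_zero] at h1
  linarith

theorem projU_isIrreducible (hV : 3 ≤ finrank ℝ V) :
    (ProjU V).toRepresentation.IsIrreducible := by
  refine isIrreducible_of_forall_submodule (E := OpForm V) (ρ := opRep V) (ProjU V)
    (fun h => ?_) fun N hle hN h0 =>
    eq_projU_of_invariant (by rwa [Fintype.card_fin]) (finBasis ℝ V) hle hN h0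
  have h1 := finrank_projU_real V (by omega)
  rw [h, finrank_bot] at h1
  have h2 : (3 : ℝ) ≤ finrank ℝ V := by exact_mod_cast hV
  have : (0 : ℝ) < (finrank ℝ V : ℝ) ^ 2 * ((finrank ℝ V : ℝ) ^ 2 - 4) / 3 := by
    have : (0 : ℝ) < (finrank ℝ V : ℝ) ^ 2 - 4 := by nlinarith
    positivity
  simp only [Nat.cast_zero] at h1
  linarith

end Irreducible

end AffineCurvature

end

theorem theorem4p1 {V : Type*} [AddCommGroup V] [Module ℝ V] [FiniteDimensional ℝ V]
    (m : ℕ) (hm : 4 ≤ m) (hV : Module.finrank ℝ V = m) :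
    -- the first sequence, with inclusion, `π_a ∘ ρ₁₄` and splitting `σ_a`
    (∃ (i : (AffineCurvature.AffF V).toRepresentation.IntertwiningMap
          (AffineCurvature.CurvR V).toRepresentation)
        (p : (AffineCurvature.CurvR V).toRepresentation.IntertwiningMap
          (AffineCurvature.Alt2 V).toRepresentation)
        (s : (AffineCurvature.Alt2 V).toRepresentation.IntertwiningMap
          (AffineCurvature.CurvR V).toRepresentation),
      (∀ F, (i F : AffineCurvature.OpForm V) = F) ∧
      (∀ R, (p R : AffineCurvature.BilForm V) =
        AffineCurvature.piA (AffineCurvature.rho14 (R : AffineCurvature.OpForm V))) ∧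
      (∀ ω, (s ω : AffineCurvature.OpForm V) =
        AffineCurvature.sigmaA (ω : AffineCurvature.BilForm V)) ∧
      AffineCurvature.IsSplitShortExact i p s) ∧
    -- the second sequence, with inclusion, `π_s ∘ ρ₁₄` and splitting `σ_s`
    (∃ (i : (AffineCurvature.ProjU V).toRepresentation.IntertwiningMap
          (AffineCurvature.AffF V).toRepresentation)
        (p : (AffineCurvature.AffF V).toRepresentation.IntertwiningMap
          (AffineCurvature.SymB V).toRepresentation)
        (s : (AffineCurvature.SymB V).toRepresentation.IntertwiningMap
          (AffineCurvature.AffF V).toRepresentation),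
      (∀ U, (i U : AffineCurvature.OpForm V) = U) ∧
      (∀ F, (p F : AffineCurvature.BilForm V) =
        AffineCurvature.piS (AffineCurvature.rho14 (F : AffineCurvature.OpForm V))) ∧
      (∀ ψ, (s ψ : AffineCurvature.OpForm V) =
        AffineCurvature.sigmaS (ψ : AffineCurvature.BilForm V)) ∧
      AffineCurvature.IsSplitShortExact i p s) ∧
    -- the resulting decomposition into irreducible modules
    (∃ e : ((AffineCurvature.ProjU V).toRepresentation.prod
          (AffineCurvature.SymB V).toRepresentation).Equiv
          (AffineCurvature.AffF V).toRepresentation,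
      ∀ U ψ, (e (U, ψ) : AffineCurvature.OpForm V) =
        (U : AffineCurvature.OpForm V) +
          AffineCurvature.sigmaS (ψ : AffineCurvature.BilForm V)) ∧
    (AffineCurvature.ProjU V).toRepresentation.IsIrreducible ∧
    (AffineCurvature.SymB V).toRepresentation.IsIrreducible ∧
    -- the dimensions
    (Module.finrank ℝ (AffineCurvature.ProjU V).toSubmodule : ℝ) =
      (m : ℝ) ^ 2 * ((m : ℝ) ^ 2 - 4) / 3 ∧
    (Module.finrank ℝ (AffineCurvature.SymB V).toSubmodule : ℝ) =
      (m : ℝ) * ((m : ℝ) + 1) / 2 ∧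
    (Module.finrank ℝ (AffineCurvature.AffF V).toSubmodule : ℝ) =
      (m : ℝ) * ((m : ℝ) - 1) * (2 * (m : ℝ) ^ 2 + 2 * (m : ℝ) - 3) / 6 := by
  subst hV
  have h1 : 1 < Module.finrank ℝ V := by omega
  exact ⟨⟨AffineCurvature.inclAffCurv V, AffineCurvature.projAlt V, AffineCurvature.splitAlt V,
      fun _ => rfl, fun _ => rfl, fun _ => rfl, AffineCurvature.isSplitShortExact_alt V⟩,
    ⟨AffineCurvature.inclUAff V, AffineCurvature.projSym V, AffineCurvature.splitSym V h1,
      fun _ => rfl, fun _ => rfl, fun _ => rfl, AffineCurvature.isSplitShortExact_sym V h1⟩,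
    ⟨AffineCurvature.sumEquiv V h1, fun _ _ => rfl⟩,
    AffineCurvature.projU_isIrreducible V (by omega),
    AffineCurvature.symB_isIrreducible V (by omega),
    AffineCurvature.finrank_projU_real V h1, AffineCurvature.finrank_symB_real V,
    AffineCurvature.finrank_affF_real V⟩
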